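/- Let $G$ be a finite undirected graph without loops and parallel edges, with node set $VG$ and edge set $EG$. A \emph{2-matching} in $G$ is a function $x\colon EG\to\{0,1,2\}$ such that for each node $v$ the sum of $x(e)$ over all edges $e$ incident to $v$ is at most $2$. It is \emph{perfect} if $\sum_{e\in EG}x(e)=|VG|$, \emph{triangle-free} if $\{e\in EG : x(e)\neq 0\}$ contains no triangle, and \emph{basic} if $\{e\in EG : x(e)=1\}$ partitions into a collection of node-disjoint circuits of odd length. \textbf{Theorem.} A perfect triangle-free (and basic) 2-matching in a 3-regular graph can be found in linear time. That is, there are a constant $C$ and a single program for a unit-cost random access machine (with addition, truncated subtraction, comparisons and indirect addressing) that do the following for every $n$ and every 3-regular graph $G$ with node set $\{0,\dots,n-1\}$, given by $n$ and by adjacency lists in any order. The program halts after at most $C(n+1)$ steps, using only numbers and memory addresses that are at most $C(n+1)$ (so that words of $O(\log n)$ bits suffice), and outputs the values $x(e)$, $e\in EG$, of a basic perfect triangle-free 2-matching $x$ in $G$. -/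

import Mathlib

open Classical in
/-- The sum of the values of `x` on the edges of `G` that are incident to `v`. -/
noncomputable def incidentSum {V : Type*} [Fintype V] {G : SimpleGraph V}
    (x : G.edgeSet → ℕ) (v : V) : ℕ :=
  ∑ e : G.edgeSet, if v ∈ (e : Sym2 V) then x e else 0

/-- A 2-matching: a function from the edges to `{0, 1, 2}` such that at each node the values on the
incident edges sum to at most 2. -/
def IsTwoMatching {V : Type*} [Fintype V] {G : SimpleGraph V} (x : G.edgeSet → ℕ) : Prop :=
  (∀ e, x e ≤ 2) ∧ ∀ v, incidentSum x v ≤ 2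

open Classical in
/-- The size of `x` is the sum of all its values. -/
noncomputable def edgeSize {V : Type*} [Fintype V] {G : SimpleGraph V} (x : G.edgeSet → ℕ) : ℕ :=
  ∑ e : G.edgeSet, x e

/-- `x` is perfect if its size is the number of nodes. -/
def IsPerfect {V : Type*} [Fintype V] {G : SimpleGraph V} (x : G.edgeSet → ℕ) : Prop :=
  edgeSize x = Fintype.card V

/-- `x` is basic if the edges of value 1 partition into node-disjoint circuits of odd length. -/
def IsBasic {V : Type*} {G : SimpleGraph V} (x : G.edgeSet → ℕ) : Prop :=
  ∃ 𝒞 : Set (Σ v : V, G.Walk v v),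
    (∀ c ∈ 𝒞, c.2.IsCycle ∧ Odd c.2.length) ∧
    𝒞.PairwiseDisjoint (fun c => {v : V | v ∈ c.2.support}) ∧
    ∀ e : G.edgeSet, x e = 1 ↔ ∃ c ∈ 𝒞, (e : Sym2 V) ∈ c.2.edges

/-- The spanning subgraph of `G` whose edges are those with `x e ≠ 0`. -/
def suppGraph {V : Type*} {G : SimpleGraph V} (x : G.edgeSet → ℕ) : SimpleGraph V :=
  SimpleGraph.fromEdgeSet {e : Sym2 V | ∃ h : e ∈ G.edgeSet, x ⟨e, h⟩ ≠ 0}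

/-- `x` is triangle-free if its support contains no triangle. -/
def IsTriangleFree {V : Type*} {G : SimpleGraph V} (x : G.edgeSet → ℕ) : Prop :=
  (suppGraph x).CliqueFree 3

namespace RAM

/-- A configuration of the random access machine: the registers, and banks of memory cells, a cell
being given by its bank and its address. A program names each register and each bank that it uses
by a literal, so it uses only finitely many of them; only addresses can be computed. -/
structure State where
  reg : ℕ → ℕ
  mem : ℕ → ℕ → ℕ

/-- Contents of register `i` replaced by `w`. -/
def State.setReg (s : State) (i w : ℕ) : State :=
  { s with reg := Function.update s.reg i w }

/-- Contents of the cell with address `a` in bank `b` replaced by `w`. -/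
def State.setMem (s : State) (b a w : ℕ) : State :=
  { s with mem := Function.update s.mem b (Function.update (s.mem b) a w) }

/-- Tests: comparisons of two registers. -/
inductive Test where
  | eq (i j : ℕ)
  | lt (i j : ℕ)

/-- Truth of a test in a configuration. -/
def Test.Holds : Test → State → Prop
  | .eq i j, s => s.reg i = s.reg j
  | .lt i j, s => s.reg i < s.reg j

/-- Programs of the random access machine. `sub` is truncated subtraction, `load d b i` reads into
register `d` the cell of bank `b` whose address is in register `i`, and `store b i j` writes the
contents of register `j` into the cell of bank `b` whose address is in register `i`. -/
inductive Prog where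
  | skip
  | const (d k : ℕ)
  | move (d i : ℕ)
  | add (d i j : ℕ)
  | sub (d i j : ℕ)
  | load (d b i : ℕ)
  | store (b i j : ℕ)
  | seq (p q : Prog)
  | branch (c : Test) (p q : Prog)
  | loop (c : Test) (p : Prog)

/-- `Runs W p s t s'`: on a machine whose words hold the numbers `0, …, W`, the program `p`, started
in `s`, halts in `s'` after exactly `t` steps. Each elementary instruction and each evaluation of a
test is one step. An instruction whose result does not fit into a word cannot be executed. -/
inductive Runs (W : ℕ) : Prog → State → ℕ → State → Prop where
  | skip (s : State) : Runs W .skip s 1 s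
  | const (d k : ℕ) (s : State) (h : k ≤ W) : Runs W (.const d k) s 1 (s.setReg d k)
  | move (d i : ℕ) (s : State) : Runs W (.move d i) s 1 (s.setReg d (s.reg i))
  | add (d i j : ℕ) (s : State) (h : s.reg i + s.reg j ≤ W) :
      Runs W (.add d i j) s 1 (s.setReg d (s.reg i + s.reg j))
  | sub (d i j : ℕ) (s : State) : Runs W (.sub d i j) s 1 (s.setReg d (s.reg i - s.reg j))
  | load (d b i : ℕ) (s : State) : Runs W (.load d b i) s 1 (s.setReg d (s.mem b (s.reg i)))
  | store (b i j : ℕ) (s : State) :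
      Runs W (.store b i j) s 1 (s.setMem b (s.reg i) (s.reg j))
  | seq {p q : Prog} {s s' s'' : State} {t t' : ℕ} (hp : Runs W p s t s')
      (hq : Runs W q s' t' s'') : Runs W (.seq p q) s (t + t') s''
  | branch_true {c : Test} {p q : Prog} {s s' : State} {t : ℕ} (hc : c.Holds s)
      (hp : Runs W p s t s') : Runs W (.branch c p q) s (t + 1) s'
  | branch_false {c : Test} {p q : Prog} {s s' : State} {t : ℕ} (hc : ¬ c.Holds s)
      (hq : Runs W q s t s') : Runs W (.branch c p q) s (t + 1) s'
  | loop_false {c : Test} {p : Prog} {s : State} (hc : ¬ c.Holds s) : Runs W (.loop c p) s 1 s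
  | loop_true {c : Test} {p : Prog} {s s' s'' : State} {t t' : ℕ} (hc : c.Holds s)
      (hp : Runs W p s t s') (hl : Runs W (.loop c p) s' t' s'') :
      Runs W (.loop c p) s (t + t' + 1) s''

end RAM

/-- Adjacency lists of a 3-regular graph on the nodes `0, …, n - 1`: for each node, its
neighbours listed without repetition in some order. -/
structure CubicAdjList {n : ℕ} (G : SimpleGraph (Fin n)) where
  nbr : Fin n → Fin 3 → Fin n
  injective : ∀ v, Function.Injective (nbr v)
  adj_iff : ∀ v w, G.Adj v w ↔ ∃ j, nbr v j = w

/-- The edge from `v` to the entry number `j` in its adjacency list. -/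
def CubicAdjList.edge {n : ℕ} {G : SimpleGraph (Fin n)} (A : CubicAdjList G) (v : Fin n)
    (j : Fin 3) : G.edgeSet :=
  ⟨s(v, A.nbr v j), (A.adj_iff v _).2 ⟨j, rfl⟩⟩

/-- The initial configuration: register 0 holds `n`, the cell `3 * v + j` of bank 0 holds the entry
number `j` in the adjacency list of `v`, and everything else is 0. -/
def CubicAdjList.input {n : ℕ} {G : SimpleGraph (Fin n)} (A : CubicAdjList G) : RAM.State where
  reg i := if i = 0 then n else 0
  mem b a := if h : b = 0 ∧ a / 3 < n then
    (A.nbr ⟨a / 3, h.2⟩ ⟨a % 3, Nat.mod_lt a (by decide)⟩ : ℕ) else 0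

/-- The output convention: the cell `3 * v + j` of bank 1 holds the value of `x` on the edge from
`v` to the entry number `j` in its adjacency list. -/
def CubicAdjList.Outputs {n : ℕ} {G : SimpleGraph (Fin n)} (A : CubicAdjList G) (s : RAM.State)
    (x : G.edgeSet → ℕ) : Prop :=
  ∀ (v : Fin n) (j : Fin 3), s.mem 1 (3 * (v : ℕ) + (j : ℕ)) = x (A.edge v j)

/-! Contract a maximal family of node-disjoint triangles. The result is a cubic multigraph, and its
bipartite double cover (a left and a right copy of each node, an edge for each arc) is a cubic
bipartite multigraph, so it has a perfect matching. The matching selects one outgoing and one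
incoming arc at each contracted node. At a contracted triangle this extends to the three original
nodes: if both arcs are at the same node, the other two nodes are swapped; otherwise the path runs
from the entry through all three nodes to the exit. This gives a permutation of the nodes along
edges of the graph. It has no cycle of length 3: by maximality such a cycle would meet a contracted
triangle, but a cycle that meets one has length 2 or passes through its three nodes and then a
fourth one (`CoverMatching.arcPerm`). The 2-matching has value 1 on odd cycles and alternately 2 and
0 on even cycles, a cycle of length 2 being a single edge of value 2 (`ColoredPerm`).

The crux for linear time is the matching. Induction works for a stronger claim: a cubic bipartite
multigraph has a perfect matching that avoids a prescribed edge `e`. Let `u` be the left end of `e`,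
let `f` be a second edge at `u` and `v` its other end. Delete `u` and `v` and join the four loose
ends by two new edges, one of which takes over the right slot `z` of `e` and is the next edge to
avoid (`Bipartite.delete`). A matching that avoids it is extended by `f`, or, if it uses the other
new edge, by putting two old edges in place of that edge (`PerfectAvoiding.of_delete`). A deletion
takes constant time and is logged; the log is replayed backwards.

Code without loops is verified by weakest preconditions, loops by potentials that pay for the steps
(`Reaches.loop`). The bound `20 * (n + 1) ≤ W` keeps all arithmetic within a word. -/

namespace RAM

/-! ### Program logic: weakest preconditions and loops with potentials -/

@[simp] theorem State.setReg_reg (s : State) (d w i : ℕ) :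
    (s.setReg d w).reg i = if i = d then w else s.reg i := by
  simp [State.setReg, Function.update_apply]

@[simp] theorem State.setReg_mem (s : State) (d w : ℕ) : (s.setReg d w).mem = s.mem := rfl

@[simp] theorem State.setMem_reg (s : State) (b a w : ℕ) : (s.setMem b a w).reg = s.reg := rfl

@[simp] theorem State.setMem_mem (s : State) (b a w b' : ℕ) :
    (s.setMem b a w).mem b' = if b' = b then Function.update (s.mem b) a w else s.mem b' := by
  simp only [State.setMem, Function.update_apply]

/-- Sequential composition of a list of programs. -/
def block : List Prog → Prog
  | [] => .skip
  | p :: ps => .seq p (block ps)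

/-- A bound for the number of steps of a program without loops. -/
def Prog.cost : Prog → ℕ
  | .seq p q => p.cost + q.cost
  | .branch _ p q => max p.cost q.cost + 1
  | _ => 1

/-- Weakest preconditions of programs without loops. -/
def wp (W : ℕ) : Prog → (State → Prop) → State → Prop
  | .skip, Q, s => Q s
  | .const d k, Q, s => k ≤ W ∧ Q (s.setReg d k)
  | .move d i, Q, s => Q (s.setReg d (s.reg i))
  | .add d i j, Q, s => s.reg i + s.reg j ≤ W ∧ Q (s.setReg d (s.reg i + s.reg j))
  | .sub d i j, Q, s => Q (s.setReg d (s.reg i - s.reg j))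
  | .load d b i, Q, s => Q (s.setReg d (s.mem b (s.reg i)))
  | .store b i j, Q, s => Q (s.setMem b (s.reg i) (s.reg j))
  | .seq p q, Q, s => wp W p (wp W q Q) s
  | .branch c p q, Q, s => (c.Holds s → wp W p Q s) ∧ (¬ c.Holds s → wp W q Q s)
  | .loop _ _, _, _ => False

@[simp] theorem wp_block_nil {W : ℕ} {Q : State → Prop} {s : State} :
    wp W (block []) Q s = Q s := rfl

@[simp] theorem wp_block_cons {W : ℕ} {p : Prog} {ps : List Prog} {Q : State → Prop} {s : State} :
    wp W (block (p :: ps)) Q s = wp W p (wp W (block ps) Q) s := rfl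

/-- Started in `s`, the program `p` halts after at most `T` steps in a state that satisfies `Q`. -/
def Reaches (W : ℕ) (p : Prog) (s : State) (T : ℕ) (Q : State → Prop) : Prop :=
  ∃ t s', Runs W p s t s' ∧ t ≤ T ∧ Q s'

theorem Reaches.of_wp {W : ℕ} {p : Prog} {Q : State → Prop} {s : State} (h : wp W p Q s) :
    Reaches W p s p.cost Q := by
  induction p generalizing Q s with
  | skip => exact ⟨1, s, .skip s, le_rfl, h⟩
  | const d k => exact ⟨1, _, .const d k s h.1, le_rfl, h.2⟩
  | move d i => exact ⟨1, _, .move d i s, le_rfl, h⟩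
  | add d i j => exact ⟨1, _, .add d i j s h.1, le_rfl, h.2⟩
  | sub d i j => exact ⟨1, _, .sub d i j s, le_rfl, h⟩
  | load d b i => exact ⟨1, _, .load d b i s, le_rfl, h⟩
  | store b i j => exact ⟨1, _, .store b i j s, le_rfl, h⟩
  | seq p q ihp ihq =>
    obtain ⟨t, s', hp, ht, h'⟩ := ihp h
    obtain ⟨t', s'', hq, ht', h''⟩ := ihq h'
    exact ⟨_, _, .seq hp hq, Nat.add_le_add ht ht', h''⟩
  | branch c p q ihp ihq =>
    by_cases hc : c.Holds s
    · obtain ⟨t, s', hp, ht, h'⟩ := ihp (h.1 hc)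
      exact ⟨_, _, .branch_true hc hp, by simp only [Prog.cost]; omega, h'⟩
    · obtain ⟨t, s', hq, ht, h'⟩ := ihq (h.2 hc)
      exact ⟨_, _, .branch_false hc hq, by simp only [Prog.cost]; omega, h'⟩
  | loop c p => exact h.elim

theorem Reaches.mono {W : ℕ} {p : Prog} {s : State} {T T' : ℕ} {Q Q' : State → Prop}
    (h : Reaches W p s T Q) (hT : T ≤ T') (hQ : ∀ s', Q s' → Q' s') : Reaches W p s T' Q' := by
  obtain ⟨t, s', hr, ht, h'⟩ := h
  exact ⟨t, s', hr, ht.trans hT, hQ s' h'⟩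

theorem Reaches.seq {W : ℕ} {p q : Prog} {s : State} {T T' : ℕ} {Q R : State → Prop}
    (h : Reaches W p s T Q) (h' : ∀ s', Q s' → Reaches W q s' T' R) :
    Reaches W (.seq p q) s (T + T') R := by
  obtain ⟨t, s', hp, ht, hQ⟩ := h
  obtain ⟨t', s'', hq, ht', hR⟩ := h' s' hQ
  exact ⟨_, _, .seq hp hq, Nat.add_le_add ht ht', hR⟩

theorem Reaches.branch {W : ℕ} {c : Test} {p q : Prog} {s : State} {T : ℕ} {Q : State → Prop}
    (hp : c.Holds s → Reaches W p s T Q) (hq : ¬ c.Holds s → Reaches W q s T Q) :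
    Reaches W (.branch c p q) s (T + 1) Q := by
  by_cases hc : c.Holds s
  · obtain ⟨t, s', hr, ht, h'⟩ := hp hc
    exact ⟨_, _, .branch_true hc hr, by omega, h'⟩
  · obtain ⟨t, s', hr, ht, h'⟩ := hq hc
    exact ⟨_, _, .branch_false hc hr, by omega, h'⟩

/-- Loops, with a potential that pays for the steps. -/
theorem Reaches.loop {W : ℕ} {c : Test} {p : Prog} (I : ℕ → State → Prop)
    (h : ∀ k s, I k s → c.Holds s →
      ∃ T, Reaches W p s T fun s' => ∃ k', I k' s' ∧ T + 1 + k' ≤ k) (k : ℕ) (s : State)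
    (hI : I k s) :
    ∃ k', k' ≤ k ∧ Reaches W (.loop c p) s (k - k' + 1) fun s' => I k' s' ∧ ¬ c.Holds s' := by
  induction k using Nat.strong_induction_on generalizing s with
  | _ k ih =>
    by_cases hc : c.Holds s
    · obtain ⟨T, t, s', hr, ht, k', hI', hk⟩ := h k s hI hc
      obtain ⟨k'', hk'', t', s'', hr', ht', h''⟩ := ih k' (by omega) s' hI'
      exact ⟨k'', by omega, _, s'', .loop_true hc hr hr', by omega, h''⟩
    · exact ⟨k, le_rfl, 1, s, .loop_false hc, by omega, hI, hc⟩

/-- Loops that count the register `i` up to the contents `N` of the register `j`. -/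
theorem Reaches.loop_lt {W : ℕ} {i j N T : ℕ} {p : Prog} (I : ℕ → State → Prop)
    (hi : ∀ m s, I m s → s.reg i = m ∧ s.reg j = N)
    (h : ∀ m s, m < N → I m s → Reaches W p s T (I (m + 1))) {s : State} (hI : I 0 s) :
    Reaches W (.loop (.lt i j) p) s ((T + 1) * N + 1) (I N) := by
  obtain ⟨k', hk', hr⟩ := Reaches.loop (W := W) (c := .lt i j) (p := p)
    (fun k s => ∃ m, m ≤ N ∧ k = (T + 1) * (N - m) ∧ I m s)
    (by
      rintro k s ⟨m, hm, rfl, hs⟩ hc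
      obtain ⟨h1, h2⟩ := hi m s hs
      simp only [Test.Holds, h1, h2] at hc
      refine ⟨T, (h m s hc hs).mono le_rfl fun s' hs' => ⟨_, ⟨m + 1, hc, rfl, hs'⟩, ?_⟩⟩
      rw [show N - m = N - (m + 1) + 1 by omega]
      linarith) ((T + 1) * (N - 0)) s ⟨0, Nat.zero_le _, rfl, hI⟩
  refine hr.mono (by rw [Nat.sub_zero]; omega) ?_
  rintro s' ⟨⟨m, hm, -, hs⟩, hc⟩
  obtain ⟨h1, h2⟩ := hi m s' hs
  simp only [Test.Holds, h1, h2] at hc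
  obtain rfl : m = N := by omega
  exact hs

end RAM

/-! ### Cubic graphs as arrays of arcs -/

/-- Arrays that describe a cubic graph on `0, …, n - 1`: the slot `s < 3 * n` is an arc from
`s / 3` to `nb s`, and `op s` is the reverse arc. -/
structure Arcs (n : ℕ) (nb op : ℕ → ℕ) : Prop where
  nb_lt : ∀ s < 3 * n, nb s < n
  op_lt : ∀ s < 3 * n, op s < 3 * n
  op_div : ∀ s < 3 * n, op s / 3 = nb s
  nb_op : ∀ s < 3 * n, nb (op s) = s / 3
  op_op : ∀ s < 3 * n, op (op s) = s
  inj : ∀ s < 3 * n, ∀ t < 3 * n, s / 3 = t / 3 → nb s = nb t → s = t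
  ne : ∀ s < 3 * n, nb s ≠ s / 3

/-- The slot of the arc from `a` to `b`, computed without tests. -/
def slotOf (nb : ℕ → ℕ) (a b : ℕ) : ℕ :=
  a + a + a + (1 - (b - nb (a + a + a + 1) + (nb (a + a + a + 1) - b))) +
    (1 - (b - nb (a + a + a + 1 + 1) + (nb (a + a + a + 1 + 1) - b))) +
    (1 - (b - nb (a + a + a + 1 + 1) + (nb (a + a + a + 1 + 1) - b)))

/-- Each factor `1 - |b - nb _|` is the indicator of an equality. As the three neighbours are
distinct, at most one indicator is 1; if none is, the answer is slot `3 * a`. -/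
theorem slotOf_eq {n : ℕ} {nb : ℕ → ℕ}
    (inj : ∀ s < 3 * n, ∀ t < 3 * n, s / 3 = t / 3 → nb s = nb t → s = t)
    {c : ℕ} (hc : c < 3 * n) : slotOf nb (c / 3) (nb c) = c := by
  obtain ⟨a, ha⟩ : ∃ a, a = c / 3 := ⟨_, rfl⟩
  have h1 := inj c hc (a + a + a + 1) (by omega) (by omega)
  have h2 := inj c hc (a + a + a + 1 + 1) (by omega) (by omega)
  have h : c = a + a + a ∨ c = a + a + a + 1 ∨ c = a + a + a + 1 + 1 := by omega
  rw [← ha, slotOf]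
  rcases h with h | h | h
  · have h1' : nb c ≠ nb (a + a + a + 1) := fun h' => by have := h1 h'; omega
    have h2' : nb c ≠ nb (a + a + a + 1 + 1) := fun h' => by have := h2 h'; omega
    omega
  · have h2' : nb c ≠ nb (a + a + a + 1 + 1) := fun h' => by have := h2 h'; omega
    have h3 : nb (a + a + a + 1) = nb c := by rw [h]
    omega
  · have h1' : nb c ≠ nb (a + a + a + 1) := fun h' => by have := h1 h'; omega
    have h3 : nb (a + a + a + 1 + 1) = nb c := by rw [h]
    omega

/-- Needed also when `b` is not a neighbour of `a`: the search for triangles looks up the closing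
arc before knowing that it exists, and must still read a slot of `a`. -/
theorem slotOf_div {n : ℕ} {nb : ℕ → ℕ}
    (inj : ∀ s < 3 * n, ∀ t < 3 * n, s / 3 = t / 3 → nb s = nb t → s = t)
    {a : ℕ} (ha : a < n) (b : ℕ) : slotOf nb a b / 3 = a := by
  have h1 := inj (a + a + a + 1) (by omega) (a + a + a + 1 + 1) (by omega) (by omega)
  have h1' : nb (a + a + a + 1) ≠ nb (a + a + a + 1 + 1) := fun h' => by have := h1 h'; omega
  rw [slotOf]
  omega

theorem Arcs.slotOf_eq {n : ℕ} {nb op : ℕ → ℕ} (H : Arcs n nb op) {c : ℕ} (hc : c < 3 * n) :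
    slotOf nb (c / 3) (nb c) = c :=
  _root_.slotOf_eq H.inj hc

theorem Arcs.slotOf_div {n : ℕ} {nb op : ℕ → ℕ} (H : Arcs n nb op) {a : ℕ} (ha : a < n) (b : ℕ) :
    slotOf nb a b / 3 = a :=
  _root_.slotOf_div H.inj ha b

section AdjList

variable {n : ℕ} {G : SimpleGraph (Fin n)} (A : CubicAdjList G)

theorem CubicAdjList.input_slot (v : Fin n) (j : Fin 3) :
    A.input.mem 0 (3 * v + j) = A.nbr v j := by
  have h1 : (3 * (v : ℕ) + j) / 3 = v := by omega
  have h2 : (3 * (v : ℕ) + j) % 3 = j := by omega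
  simp [CubicAdjList.input, h1, h2]

theorem exists_slot {s : ℕ} (hs : s < 3 * n) : ∃ (v : Fin n) (j : Fin 3), 3 * (v : ℕ) + j = s :=
  ⟨⟨s / 3, by omega⟩, ⟨s % 3, by omega⟩, by simp only; omega⟩

theorem CubicAdjList.input_inj (s : ℕ) (hs : s < 3 * n) (t : ℕ) (ht : t < 3 * n)
    (hst : s / 3 = t / 3) (h : A.input.mem 0 s = A.input.mem 0 t) : s = t := by
  obtain ⟨v, j, rfl⟩ := exists_slot hs
  obtain ⟨w, k, rfl⟩ := exists_slot ht
  obtain rfl : v = w := by ext; omega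
  rw [A.input_slot, A.input_slot, Fin.val_inj] at h
  rw [A.injective v h]

theorem CubicAdjList.exists_reverse (s : ℕ) (hs : s < 3 * n) :
    ∃ t < 3 * n, t / 3 = A.input.mem 0 s ∧ A.input.mem 0 t = s / 3 := by
  obtain ⟨v, j, rfl⟩ := exists_slot hs
  obtain ⟨k, hk⟩ := (A.adj_iff _ _).1 ((A.adj_iff v _).2 ⟨j, rfl⟩).symm
  refine ⟨3 * (A.nbr v j : ℕ) + k, by omega, ?_, ?_⟩
  · rw [A.input_slot]; omega
  · rw [A.input_slot, hk]; omega

/-- The reverse arcs of the arcs of an adjacency list. -/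
def CubicAdjList.reverse (s : ℕ) : ℕ :=
  slotOf (A.input.mem 0) (A.input.mem 0 s) (s / 3)

/-- A reverse arc exists because adjacency is symmetric, and is unique because the lists have no
repetitions; uniqueness makes the reversal an involution. -/
theorem CubicAdjList.arcs : Arcs n (A.input.mem 0) A.reverse := by
  have key : ∀ s < 3 * n, A.reverse s < 3 * n ∧ A.reverse s / 3 = A.input.mem 0 s ∧
      A.input.mem 0 (A.reverse s) = s / 3 := by
    intro s hs
    obtain ⟨t, ht, h1, h2⟩ := A.exists_reverse s hs
    have h3 : A.reverse s = t := by
      rw [CubicAdjList.reverse, ← h1, ← h2]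
      exact slotOf_eq A.input_inj ht
    rw [h3]
    exact ⟨ht, h1, h2⟩
  have lt : ∀ s < 3 * n, A.input.mem 0 s < n := by
    intro s hs
    obtain ⟨v, j, rfl⟩ := exists_slot hs
    rw [A.input_slot]
    exact (A.nbr v j).2
  refine ⟨lt, fun s hs => (key s hs).1, fun s hs => (key s hs).2.1, fun s hs => (key s hs).2.2,
    fun s hs => ?_, A.input_inj, fun s hs => ?_⟩
  · obtain ⟨h1, h2, h3⟩ := key s hs
    obtain ⟨h4, h5, h6⟩ := key _ h1
    exact A.input_inj _ h4 _ hs (by omega) (by omega)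
  · obtain ⟨v, j, rfl⟩ := exists_slot hs
    rw [A.input_slot]
    have h := ((A.adj_iff v _).2 ⟨j, rfl⟩).ne
    intro h'
    exact h (Fin.ext (by omega))

end AdjList

/-- The cyclic successor of a slot among the three slots of a vertex. -/
def rot (s : ℕ) : ℕ := if s % 3 = 2 then s - 2 else s + 1

theorem rot_lt {n s : ℕ} (hs : s < 3 * n) : rot s < 3 * n := by
  rw [rot]; split_ifs <;> omega

theorem rot_div (s : ℕ) : rot s / 3 = s / 3 := by
  rw [rot]; split_ifs <;> omega

/-! ### Computing reverse arcs and rotations -/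

namespace RAM

/-- The registers and the memory bank that stay fixed after initialization. -/
structure Frame (n : ℕ) (nb : ℕ → ℕ) (s : State) : Prop where
  reg0 : s.reg 0 = n
  reg1 : s.reg 1 = 3 * n
  reg2 : s.reg 2 = 0
  reg3 : s.reg 3 = 1
  mem0 : s.mem 0 = nb

/-- Puts the slot of the arc from register 6 to register 7 into register 8. -/
def findSlot : Prog :=
  block [.add 8 6 6, .add 8 8 6, .add 9 8 3, .add 11 9 3, .load 9 0 9, .load 11 0 11,
    .sub 10 9 7, .sub 9 7 9, .add 9 9 10, .sub 9 3 9,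
    .sub 10 11 7, .sub 11 7 11, .add 11 11 10, .sub 11 3 11,
    .add 8 8 9, .add 8 8 11, .add 8 8 11]

/-- Computes the reverse of the arc in register 5, whose tail is in register 4. -/
def linkSlot : Prog :=
  block [.load 6 0 5, .move 7 4, findSlot, .store 2 5 8, .store 3 5 8, .store 4 5 8, .add 5 5 3]

def linkVertex : Prog :=
  block [linkSlot, linkSlot, linkSlot, block [.sub 6 5 3, .sub 7 6 3, .sub 8 7 3, .store 5 8 7,
    .store 5 7 6, .store 5 6 8, .add 4 4 3]]

/-- Sets up the constants and the arrays for reverse arcs and rotations. -/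
def link : Prog :=
  block [block [.const 3 1, .add 1 0 0, .add 1 1 0], .loop (.lt 4 0) linkVertex]

variable {n W : ℕ} {nb op : ℕ → ℕ}

theorem wp_findSlot {a b : ℕ} {s : State} {Q : State → Prop} (hW : 20 * (n + 1) ≤ W)
    (H : Arcs n nb op) (hs : Frame n nb s) (ha : s.reg 6 = a) (hb : s.reg 7 = b) (han : a < n)
    (hbn : b < n)
    (hQ : ∀ s', s'.mem = s.mem → s'.reg 8 = slotOf nb a b →
      (∀ r, r < 8 ∨ 11 < r → s'.reg r = s.reg r) → Q s') :
    wp W findSlot Q s := by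
  obtain ⟨h0, h1, h2, h3, m0⟩ := hs
  have hb1 := H.nb_lt (a + a + a + 1) (by omega)
  have hb2 := H.nb_lt (a + a + a + 1 + 1) (by omega)
  simp only [findSlot, wp_block_cons, wp_block_nil, wp,
    State.setReg_reg, State.setReg_mem, h3, ha, hb, m0, Nat.reduceEqDiff, if_true, if_false]
  refine ⟨by omega, by omega, by omega, by omega, by omega, by omega, by omega, by omega,
    by omega, hQ _ rfl rfl fun r hr => ?_⟩
  have : r ≠ 8 ∧ r ≠ 9 ∧ r ≠ 10 ∧ r ≠ 11 := by omega
  simp [this]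

/-- Bank 2 keeps the reverse arcs for good. The copies in banks 3 and 4 become the two directions
`p` and `q` of the double cover, which the deletions overwrite separately. -/
structure LinkInv (n : ℕ) (nb op : ℕ → ℕ) (v i : ℕ) (s : State) : Prop extends Frame n nb s where
  reg4 : s.reg 4 = v
  reg5 : s.reg 5 = i
  mem2 : ∀ j < i, s.mem 2 j = op j
  mem3 : ∀ j < i, s.mem 3 j = op j
  mem4 : ∀ j < i, s.mem 4 j = op j
  mem5 : ∀ j < 3 * v, s.mem 5 j = rot j
  mem_zero : ∀ b, b = 1 ∨ 5 < b → s.mem b = 0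

theorem update_eq_of_lt_succ {f g : ℕ → ℕ} {i x : ℕ} (h : ∀ j < i, f j = g j) (hx : x = g i) :
    ∀ j < i + 1, Function.update f i x j = g j := by
  intro j hj
  rw [Function.update_apply]
  split_ifs with h'
  · rw [h', hx]
  · exact h j (by omega)

theorem linkSlot_reaches (hW : 20 * (n + 1) ≤ W) (H : Arcs n nb op) {v i : ℕ} {s : State}
    (hi : i < 3 * n) (hv : i / 3 = v) (h : LinkInv n nb op v i s) :
    Reaches W linkSlot s 30 (LinkInv n nb op v (i + 1)) := by
  obtain ⟨⟨h0, h1, h2, h3, m0⟩, h4, h5, m2, m3, m4, m5, mz⟩ := h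
  have hlt := H.nb_lt i hi
  have hop : slotOf nb (nb i) v = op i := by
    rw [← hv, ← H.op_div i hi, ← H.nb_op i hi]
    exact H.slotOf_eq (H.op_lt i hi)
  refine (Reaches.of_wp (Q := LinkInv n nb op v (i + 1)) ?_).mono (by decide) fun _ h => h
  simp only [linkSlot, wp_block_cons, wp]
  refine wp_findSlot hW H (a := nb i) (b := v) ⟨?_, ?_, ?_, ?_, ?_⟩ ?_ ?_ hlt (by omega) ?_
  any_goals simp [h0, h1, h2, h3, h4, h5, m0]
  intro s' hm h8 hr
  simp [wp, hr, h8, hop, h3, h5]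
  refine ⟨by omega, ⟨?_, ?_, ?_, ?_, ?_⟩, ?_, ?_, ?_, ?_, ?_, ?_, fun b hb => ?_⟩
  any_goals simp [h0, h1, h2, h3, h4, m0, hr, hm]
  · exact fun j hj => update_eq_of_lt_succ m2 rfl j (by omega)
  · exact fun j hj => update_eq_of_lt_succ m3 rfl j (by omega)
  · exact fun j hj => update_eq_of_lt_succ m4 rfl j (by omega)
  · exact m5
  · have : b ≠ 2 ∧ b ≠ 3 ∧ b ≠ 4 := by omega
    simp [this, mz b hb]

theorem linkVertex_reaches (hW : 20 * (n + 1) ≤ W) (H : Arcs n nb op) {v : ℕ} {s : State}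
    (hv : v < n) (h : LinkInv n nb op v (3 * v) s) :
    Reaches W linkVertex s 99 (LinkInv n nb op (v + 1) (3 * (v + 1))) := by
  refine (linkSlot_reaches hW H (by omega) (by omega) h).seq (T' := 69) fun s h => ?_
  refine (linkSlot_reaches hW H (by omega) (by omega) h).seq (T' := 39) fun s h => ?_
  refine (linkSlot_reaches hW H (by omega) (by omega) h).seq (T' := 9) fun s h => ?_
  obtain ⟨⟨h0, h1, h2, h3, m0⟩, h4, h5, m2, m3, m4, m5, mz⟩ := h
  refine (Reaches.of_wp ?_).mono (by decide) fun _ h => h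
  simp [wp, h3, h4, h5]
  refine ⟨by omega, ⟨?_, ?_, ?_, ?_, ?_⟩, ?_, ?_, ?_, ?_, ?_, ?_, fun b hb => ?_⟩
  any_goals simp [h0, h1, h2, h3, h5, m0]
  · omega
  · exact m2
  · exact m3
  · exact m4
  · intro j hj
    simp only [Function.update_apply, rot]
    split_ifs <;> first | omega | skip
    all_goals
      rw [m5 j (by omega), rot]
      split_ifs
      rfl
  · have : b ≠ 5 := by omega
    simp [this, mz b hb]

theorem link_reaches (hW : 20 * (n + 1) ≤ W) (H : Arcs n nb op) {s : State}
    (hn : ∀ i, s.reg i = if i = 0 then n else 0) (m0 : s.mem 0 = nb)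
    (mz : ∀ b, b ≠ 0 → s.mem b = 0) :
    Reaches W link s (100 * n + 10) (LinkInv n nb op n (3 * n)) := by
  have h : Reaches W (block [.const 3 1, .add 1 0 0, .add 1 1 0]) s 4 (LinkInv n nb op 0 0) := by
    refine (Reaches.of_wp ?_).mono (by decide) fun _ h => h
    simp [wp, hn]
    refine ⟨by omega, by omega, by omega, ⟨?_, ?_, ?_, ?_, ?_⟩, ?_, ?_, ?_, ?_, ?_, ?_,
      fun b hb => ?_⟩
    any_goals simp [hn, m0]
    · omega
    · exact mz b (by omega)
  refine (h.seq (T' := 100 * n + 1 + 1) fun s h => ?_).mono (by omega) fun _ h => h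
  refine (Reaches.loop_lt (T := 99) (N := n) (fun v => LinkInv n nb op v (3 * v))
    (fun m s hs => ⟨hs.reg4, hs.reg0⟩) (fun m s hm hs => linkVertex_reaches hW H hm hs) h).seq
    fun s h => ?_
  exact ⟨1, s, .skip s, le_rfl, h⟩

end RAM

/-! ### Packings of disjoint triangles and their contraction -/

/-- There is an arc from `u` to `w`. -/
def HasArc (n : ℕ) (nb : ℕ → ℕ) (u w : ℕ) : Prop := ∃ c < 3 * n, c / 3 = u ∧ nb c = w

theorem HasArc.symm {n u w : ℕ} {nb op : ℕ → ℕ} (H : Arcs n nb op) (h : HasArc n nb u w) :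
    HasArc n nb w u := by
  obtain ⟨c, hc, rfl, rfl⟩ := h
  exact ⟨op c, H.op_lt c hc, H.op_div c hc, H.nb_op c hc⟩

/-- There is an arc from `u` to `w` whose slot is dead. -/
def HasDeadArc (n : ℕ) (nb dead : ℕ → ℕ) (u w : ℕ) : Prop :=
  ∃ c < 3 * n, c / 3 = u ∧ nb c = w ∧ dead c ≠ 0

theorem HasDeadArc.mono {n u w : ℕ} {nb dead dead' : ℕ → ℕ} (h : HasDeadArc n nb dead u w)
    (hd : ∀ x, dead x ≠ 0 → dead' x ≠ 0) : HasDeadArc n nb dead' u w := by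
  obtain ⟨c, hc, h1, h2, h3⟩ := h
  exact ⟨c, hc, h1, h2, hd c h3⟩

theorem HasDeadArc.hasArc {n u w : ℕ} {nb dead : ℕ → ℕ} (h : HasDeadArc n nb dead u w) :
    HasArc n nb u w := by
  obtain ⟨c, hc, h1, h2, h3⟩ := h
  exact ⟨c, hc, h1, h2⟩

/-- The live slots `s`, `s₁`, `s₂` lead out of the vertices of a contracted triangle. -/
structure Contracted (n : ℕ) (nb rho dead mk : ℕ → ℕ) (s s₁ s₂ : ℕ) : Prop where
  lt : s < 3 * n
  lt₁ : s₁ < 3 * n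
  lt₂ : s₂ < 3 * n
  rho_eq : rho s = s₁
  rho_eq₁ : rho s₁ = s₂
  rho_eq₂ : rho s₂ = s
  live : dead s = 0
  live₁ : dead s₁ = 0
  live₂ : dead s₂ = 0
  mk_ne : mk (s / 3) ≠ 0
  mk_ne₁ : mk (s₁ / 3) ≠ 0
  mk_ne₂ : mk (s₂ / 3) ≠ 0
  eq_of : ∀ t < 3 * n, t / 3 = s / 3 → dead t = 0 → t = s
  eq_of₁ : ∀ t < 3 * n, t / 3 = s₁ / 3 → dead t = 0 → t = s₁
  eq_of₂ : ∀ t < 3 * n, t / 3 = s₂ / 3 → dead t = 0 → t = s₂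
  arc : HasDeadArc n nb dead (s / 3) (s₁ / 3)
  arc₁ : HasDeadArc n nb dead (s₁ / 3) (s₂ / 3)
  arc₂ : HasDeadArc n nb dead (s₂ / 3) (s / 3)
  ne : s / 3 ≠ s₁ / 3
  ne₁ : s₁ / 3 ≠ s₂ / 3
  ne₂ : s₂ / 3 ≠ s / 3

theorem Contracted.rotate {n : ℕ} {nb rho dead mk : ℕ → ℕ} {s s₁ s₂ : ℕ}
    (h : Contracted n nb rho dead mk s s₁ s₂) : Contracted n nb rho dead mk s₁ s₂ s :=
  ⟨h.lt₁, h.lt₂, h.lt, h.rho_eq₁, h.rho_eq₂, h.rho_eq, h.live₁, h.live₂, h.live, h.mk_ne₁, h.mk_ne₂,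
    h.mk_ne, h.eq_of₁, h.eq_of₂, h.eq_of, h.arc₁, h.arc₂, h.arc, h.ne₁, h.ne₂, h.ne⟩

/-- The marked vertices are partitioned into triangles. The six inner slots of a triangle are dead,
and `rho` rotates the other three. -/
structure Packing (n : ℕ) (nb op rho dead mk : ℕ → ℕ) : Prop where
  rho_lt : ∀ s < 3 * n, rho s < 3 * n
  mk_le : ∀ v, mk v ≤ 1
  free : ∀ s < 3 * n, mk (s / 3) = 0 → dead s = 0 ∧ rho s = rot s
  tri : ∀ v < n, mk v ≠ 0 → ∃ s s₁ s₂, s / 3 = v ∧ Contracted n nb rho dead mk s s₁ s₂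
  op_live : ∀ s < 3 * n, dead s = 0 → dead (op s) = 0

/-- No triangle that starts with a slot below `i` is disjoint from the packing. -/
def MaximalBelow (n : ℕ) (nb mk : ℕ → ℕ) (i : ℕ) : Prop :=
  ∀ s < i, HasArc n nb (nb s) (nb (rot s)) → mk (s / 3) + mk (nb s) + mk (nb (rot s)) ≠ 0

/-- The slot of `a` besides `s` and `t`. -/
theorem third_slot {a s t : ℕ} (hs : s / 3 = a) (ht : t / 3 = a) (hst : s ≠ t) :
    (9 * a + 3 - s - t) / 3 = a ∧ 9 * a + 3 - s - t ≠ s ∧ 9 * a + 3 - s - t ≠ t ∧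
      ∀ r, r / 3 = a → r = s ∨ r = t ∨ r = 9 * a + 3 - s - t := by
  -- The slots of `a` are `3 * a`, `3 * a + 1`, `3 * a + 2`, with sum `9 * a + 3`.
  refine ⟨by omega, by omega, by omega, fun r hr => by omega⟩

/-- The triangle consists of the arcs `i` from `u` to `a`, `t` from `u` to `b` and `c` from `a` to
`b`. These and their reverses die, and the remaining slots `ov`, `oa`, `ob` become the slots of the
contracted vertex. Since the three vertices were unmarked, the data of earlier triangles are not
touched. The slots enter through equations so that values computed by the machine can be
substituted. -/
theorem Packing.contract {n : ℕ} {nb op rho dead mk rho' dead' mk' : ℕ → ℕ} (H : Arcs n nb op)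
    (h : Packing n nb op rho dead mk) {u a b i t c sa sb d ov oa ob : ℕ} (hi : i < 3 * n)
    (hu : i / 3 = u) (ha : nb i = a) (ht : t = rot i) (hb : nb t = b) (hc : c < 3 * n)
    (hca : c / 3 = a) (hcb : nb c = b) (hsa : sa = op i) (hsb : sb = op t) (hd : d = op c)
    (hov : ov = rot t) (hoa : oa = 9 * a + 3 - sa - c) (hob : ob = 9 * b + 3 - sb - d)
    (hmu : mk u = 0) (hma : mk a = 0) (hmb : mk b = 0)
    (hrho : rho' = Function.update (Function.update (Function.update rho ov oa) oa ob) ob ov)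
    (hdead : ∀ x, dead' x =
      if x = i ∨ x = t ∨ x = sa ∨ x = sb ∨ x = c ∨ x = d then 1 else dead x)
    (hmk : ∀ x, mk' x = if x = u ∨ x = a ∨ x = b then 1 else mk x) :
    Packing n nb op rho' dead' mk' := by
  have lt_of : ∀ x, x / 3 < n → x < 3 * n := fun x hx => by clear * - hx; omega
  have ne_of : ∀ {p q x y}, p ≠ q → x / 3 = p → y / 3 = q → x ≠ y := by
    rintro p q x y hpq hx hy rfl
    exact hpq (hx.symm.trans hy)
  have htu : t / 3 = u := by rw [ht, rot_div, hu]
  have htl : t < 3 * n := by rw [ht]; exact rot_lt hi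
  have hit : t ≠ i ∧ ov ≠ i ∧ ov ≠ t ∧ ∀ r, r / 3 = u → r = i ∨ r = t ∨ r = ov := by
    clear * - hov ht hu
    rw [hov, ht, rot, rot]
    refine ⟨?_, ?_, ?_, fun r hr => ?_⟩ <;> split_ifs <;> omega
  obtain ⟨hti, hovi, hovt, hall⟩ := hit
  have hovu : ov / 3 = u := by rw [hov, rot_div, htu]
  have hau : a ≠ u := by rw [← ha, ← hu]; exact H.ne i hi
  have hbu : b ≠ u := by rw [← hb, ← htu]; exact H.ne t htl
  have hba : b ≠ a := by rw [← hcb, ← hca]; exact H.ne c hc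
  have hun : u < n := by clear * - hu hi; omega
  have han : a < n := by rw [← ha]; exact H.nb_lt i hi
  have hbn : b < n := by rw [← hb]; exact H.nb_lt t htl
  have hsal : sa < 3 * n := by rw [hsa]; exact H.op_lt i hi
  have hsbl : sb < 3 * n := by rw [hsb]; exact H.op_lt t htl
  have hsaa : sa / 3 = a := by rw [hsa, H.op_div i hi, ha]
  have hsbb : sb / 3 = b := by rw [hsb, H.op_div t htl, hb]
  have hdb : d / 3 = b := by rw [hd, H.op_div c hc, hcb]
  have hsau : nb sa = u := by rw [hsa, H.nb_op i hi, hu]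
  have hsbu : nb sb = u := by rw [hsb, H.nb_op t htl, htu]
  have hda : nb d = a := by rw [hd, H.nb_op c hc, hca]
  have hsac : sa ≠ c := by rintro rfl; exact hbu (hcb.symm.trans hsau)
  have hsbd : sb ≠ d := by rintro rfl; exact hau (hda.symm.trans hsbu)
  obtain ⟨hoaa, hoas, hoac, halla⟩ := third_slot hsaa hca hsac
  obtain ⟨hobb, hobs, hobd, hallb⟩ := third_slot hsbb hdb hsbd
  rw [← hoa] at hoaa hoas hoac halla
  rw [← hob] at hobb hobs hobd hallb
  have hovl : ov < 3 * n := lt_of _ (hovu ▸ hun)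
  have hoal : oa < 3 * n := lt_of _ (hoaa ▸ han)
  have hobl : ob < 3 * n := lt_of _ (hobb ▸ hbn)
  have r1 : rho' ov = oa := by
    rw [hrho, Function.update_of_ne (ne_of hbu.symm hovu hobb),
      Function.update_of_ne (ne_of hau.symm hovu hoaa), Function.update_self]
  have r2 : rho' oa = ob := by
    rw [hrho, Function.update_of_ne (ne_of hba.symm hoaa hobb), Function.update_self]
  have r3 : rho' ob = ov := by rw [hrho, Function.update_self]
  have r4 : ∀ x, x / 3 ≠ u → x / 3 ≠ a → x / 3 ≠ b → rho' x = rho x ∧ dead' x = dead x := by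
    intro x h1 h2 h3
    rw [hrho, hdead, Function.update_of_ne (ne_of h3 rfl hobb),
      Function.update_of_ne (ne_of h2 rfl hoaa), Function.update_of_ne (ne_of h1 rfl hovu), if_neg]
    · exact ⟨rfl, rfl⟩
    · rintro (rfl | rfl | rfl | rfl | rfl | rfl)
      exacts [h1 hu, h1 htu, h2 hsaa, h3 hsbb, h2 hca, h3 hdb]
  have m1 : mk' u ≠ 0 := by simp [hmk]
  have m2 : mk' a ≠ 0 := by simp [hmk]
  have m3 : mk' b ≠ 0 := by simp [hmk]
  have dead_of : ∀ x, x = i ∨ x = t ∨ x = sa ∨ x = sb ∨ x = c ∨ x = d → dead' x ≠ 0 := by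
    intro x hx
    rw [hdead, if_pos hx]
    exact one_ne_zero
  have main : Contracted n nb rho' dead' mk' ov oa ob := by
    have live : ∀ x, x < 3 * n → x ≠ i → x ≠ t → x ≠ sa → x ≠ sb → x ≠ c → x ≠ d →
        mk (x / 3) = 0 → dead' x = 0 := by
      intro x hx h1 h2 h3 h4 h5 h6 h7
      rw [hdead, if_neg]
      · exact (h.free x hx h7).1
      · simp only [h1, h2, h3, h4, h5, h6, or_self, not_false_iff]
    refine ⟨hovl, hoal, hobl, r1, r2, r3,
      live ov hovl hovi hovt (ne_of hau.symm hovu hsaa) (ne_of hbu.symm hovu hsbb)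
        (ne_of hau.symm hovu hca) (ne_of hbu.symm hovu hdb) (by rwa [hovu]),
      live oa hoal (ne_of hau hoaa hu) (ne_of hau hoaa htu) hoas (ne_of hba.symm hoaa hsbb) hoac
        (ne_of hba.symm hoaa hdb) (by rwa [hoaa]),
      live ob hobl (ne_of hbu hobb hu) (ne_of hbu hobb htu) (ne_of hba hobb hsaa) hobs
        (ne_of hba hobb hca) hobd (by rwa [hobb]),
      by rwa [hovu], by rwa [hoaa], by rwa [hobb], ?_, ?_, ?_,
      ⟨i, hi, hu.trans hovu.symm, ha.trans hoaa.symm, dead_of i (by simp)⟩,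
      ⟨c, hc, hca.trans hoaa.symm, hcb.trans hobb.symm, dead_of c (by simp)⟩,
      ⟨sb, hsbl, hsbb.trans hobb.symm, hsbu.trans hovu.symm, dead_of sb (by simp)⟩,
      by rw [hovu, hoaa]; exact hau.symm, by rw [hoaa, hobb]; exact hba.symm,
      by rw [hobb, hovu]; exact hbu⟩
    · intro x hx hx' hd
      rcases hall x (hx'.trans hovu) with h' | h' | h'
      · exact absurd hd (dead_of x (by simp [h']))
      · exact absurd hd (dead_of x (by simp [h']))
      · exact h'
    · intro x hx hx' hd
      rcases halla x (hx'.trans hoaa) with h' | h' | h'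
      · exact absurd hd (dead_of x (by simp [h']))
      · exact absurd hd (dead_of x (by simp [h']))
      · exact h'
    · intro x hx hx' hd
      rcases hallb x (hx'.trans hobb) with h' | h' | h'
      · exact absurd hd (dead_of x (by simp [h']))
      · exact absurd hd (dead_of x (by simp [h']))
      · exact h'
  have mk_ne_of : ∀ x, mk x ≠ 0 → mk' x ≠ 0 := by
    intro x hx
    rw [hmk]
    split_ifs
    exacts [one_ne_zero, hx]
  have dead_mono : ∀ x, dead x ≠ 0 → dead' x ≠ 0 := by
    intro x hx
    rw [hdead]
    split_ifs
    exacts [one_ne_zero, hx]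
  refine ⟨?_, ?_, ?_, ?_, ?_⟩
  · intro s hs
    have := h.rho_lt s hs
    rw [hrho]
    simp only [Function.update_apply]
    split_ifs <;> assumption
  · intro v
    have := h.mk_le v
    rw [hmk]
    split_ifs
    exacts [le_rfl, this]
  · intro s hs hm
    rw [hmk] at hm
    split_ifs at hm with h'
    rw [not_or, not_or] at h'
    obtain ⟨h1, h2⟩ := r4 s h'.1 h'.2.1 h'.2.2
    rw [h1, h2]
    exact h.free s hs hm
  · intro v hv hm
    by_cases h1 : v = u
    · exact ⟨_, _, _, hovu.trans h1.symm, main⟩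
    by_cases h2 : v = a
    · exact ⟨_, _, _, hoaa.trans h2.symm, main.rotate⟩
    by_cases h3 : v = b
    · exact ⟨_, _, _, hobb.trans h3.symm, main.rotate.rotate⟩
    rw [hmk, if_neg (by simp [h1, h2, h3])] at hm
    obtain ⟨s, s₁, s₂, hs, T⟩ := h.tri v hv hm
    have key : ∀ x, mk (x / 3) ≠ 0 → rho' x = rho x ∧ dead' x = dead x := by
      intro x hx
      exact r4 x (by rintro h'; exact hx (h' ▸ hmu)) (by rintro h'; exact hx (h' ▸ hma))
        (by rintro h'; exact hx (h' ▸ hmb))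
    refine ⟨s, s₁, s₂, hs, T.lt, T.lt₁, T.lt₂, ?_, ?_, ?_, ?_, ?_, ?_, mk_ne_of _ T.mk_ne,
      mk_ne_of _ T.mk_ne₁, mk_ne_of _ T.mk_ne₂, ?_, ?_, ?_, T.arc.mono dead_mono, T.arc₁.mono dead_mono,
      T.arc₂.mono dead_mono, T.ne, T.ne₁, T.ne₂⟩
    · rw [(key s T.mk_ne).1, T.rho_eq]
    · rw [(key s₁ T.mk_ne₁).1, T.rho_eq₁]
    · rw [(key s₂ T.mk_ne₂).1, T.rho_eq₂]
    · rw [(key s T.mk_ne).2, T.live]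
    · rw [(key s₁ T.mk_ne₁).2, T.live₁]
    · rw [(key s₂ T.mk_ne₂).2, T.live₂]
    · intro x hx hx' hd
      rw [(key x (hx' ▸ T.mk_ne)).2] at hd
      exact T.eq_of x hx hx' hd
    · intro x hx hx' hd
      rw [(key x (hx' ▸ T.mk_ne₁)).2] at hd
      exact T.eq_of₁ x hx hx' hd
    · intro x hx hx' hd
      rw [(key x (hx' ▸ T.mk_ne₂)).2] at hd
      exact T.eq_of₂ x hx hx' hd
  · intro s hs hd0
    rw [hdead] at hd0
    split_ifs at hd0 with h'
    -- The six new dead slots form three pairs of opposite arcs, so the set of dead slots stays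
    -- closed under reversal.
    have hos := H.op_op s hs
    rw [hdead, if_neg]
    · exact h.op_live s hs hd0
    · intro h1
      apply h'
      rw [← hos]
      rcases h1 with h1 | h1 | h1 | h1 | h1 | h1 <;> rw [h1]
      · simp [hsa]
      · simp [hsb]
      · simp [hsa, H.op_op i hi]
      · simp [hsb, H.op_op t htl]
      · simp [hd]
      · simp [hd, H.op_op c hc]

theorem MaximalBelow.mono {n i : ℕ} {nb mk mk' : ℕ → ℕ} (h : MaximalBelow n nb mk i)
    (hmk : ∀ x, mk x ≤ mk' x) : MaximalBelow n nb mk' i := by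
  intro s hs hc
  have := h s hs hc
  have h1 := hmk (s / 3)
  have h2 := hmk (nb s)
  have h3 := hmk (nb (rot s))
  omega

theorem MaximalBelow.succ {n i : ℕ} {nb mk : ℕ → ℕ} (h : MaximalBelow n nb mk i)
    (hi : HasArc n nb (nb i) (nb (rot i)) → mk (i / 3) + mk (nb i) + mk (nb (rot i)) ≠ 0) :
    MaximalBelow n nb mk (i + 1) := by
  intro s hs
  obtain h' | rfl : s < i ∨ s = i := by omega
  · exact h s h'
  · exact hi

theorem Arcs.congr {n : ℕ} {nb op op' : ℕ → ℕ} (H : Arcs n nb op)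
    (h : ∀ s < 3 * n, op' s = op s) : Arcs n nb op' := by
  refine ⟨H.nb_lt, fun s hs => ?_, fun s hs => ?_, fun s hs => ?_, fun s hs => ?_, H.inj, H.ne⟩
  · rw [h s hs]; exact H.op_lt s hs
  · rw [h s hs]; exact H.op_div s hs
  · rw [h s hs]; exact H.nb_op s hs
  · rw [h s hs, h _ (H.op_lt s hs)]; exact H.op_op s hs

/-! ### Contracting a maximal family of triangles -/

namespace RAM

variable {n W : ℕ} {nb op : ℕ → ℕ}

/-- Contracts the triangle of the arcs in registers 4, 5, 8; the reverse arcs of the first two are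
in registers 12 and 13, the vertices in registers 14, 6, 7. -/
def contract : Prog :=
  block [.load 17 5 5, .load 18 2 8,
    .add 19 6 6, .add 19 19 6, .add 20 19 19, .add 20 20 19, .add 20 20 3, .add 20 20 3,
    .add 20 20 3, .sub 20 20 12, .sub 20 20 8,
    .add 19 7 7, .add 19 19 7, .add 21 19 19, .add 21 21 19, .add 21 21 3, .add 21 21 3,
    .add 21 21 3, .sub 21 21 13, .sub 21 21 18,
    .store 5 17 20, .store 5 20 21, .store 5 21 17, .store 6 4 3, .store 6 5 3, .store 6 12 3,
    .store 6 13 3, .store 6 8 3, .store 6 18 3, .store 7 14 3, .store 7 6 3, .store 7 7 3]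

/-- Looks for a triangle that starts with the arc in register 4. -/
def packSlot : Prog :=
  block [.load 5 5 4, .load 6 0 4, .load 7 0 5, .load 12 2 4, .load 13 2 5, .load 14 0 12, findSlot,
    .load 15 0 8, .load 16 7 14, .load 17 7 6, .load 18 7 7, .add 16 16 17, .add 16 16 18,
    .sub 17 15 7, .sub 18 7 15, .add 16 16 17, .add 16 16 18, .branch (.eq 16 2) contract .skip,
    .add 4 4 3]

/-- Contracts a maximal family of disjoint triangles. -/
def pack : Prog :=
  block [.const 4 0, .loop (.lt 4 1) packSlot]

/-- Banks 5, 6, 7 hold the rotation, the dead slots and the marks. `mem_zero` guarantees that later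
phases find their arrays cleared. -/
structure PackInv (n : ℕ) (nb op : ℕ → ℕ) (i : ℕ) (s : State) : Prop extends Frame n nb s where
  reg4 : s.reg 4 = i
  mem2 : s.mem 2 = op
  mem3 : ∀ j < 3 * n, s.mem 3 j = op j
  mem4 : ∀ j < 3 * n, s.mem 4 j = op j
  packing : Packing n nb op (s.mem 5) (s.mem 6) (s.mem 7)
  maximal : MaximalBelow n nb (s.mem 7) i
  mem_zero : ∀ b, b = 1 ∨ 7 < b → s.mem b = 0

theorem packSlot_reaches (hW : 20 * (n + 1) ≤ W) (H : Arcs n nb op) {i : ℕ} {s : State}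
    (hi : i < 3 * n) (h : PackInv n nb op i s) :
    Reaches W packSlot s 100 (PackInv n nb op (i + 1)) := by
  obtain ⟨⟨h0, h1, h2, h3, m0⟩, h4, m2, m3, m4, P, M, mz⟩ := h
  have hlt := H.nb_lt i hi
  have hrho := P.rho_lt i hi
  -- The machine cannot divide: the tail `i / 3` is read off as the head of the reverse arc.
  have hu := H.nb_op i hi
  refine (Reaches.of_wp (Q := PackInv n nb op (i + 1)) ?_).mono (by decide) fun _ h => h
  simp only [packSlot, wp_block_cons, wp]
  obtain ⟨t, ht⟩ : ∃ t, t = s.mem 5 i := ⟨_, rfl⟩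
  obtain ⟨a, ha⟩ : ∃ a, a = nb i := ⟨_, rfl⟩
  obtain ⟨b, hb⟩ : ∃ b, b = nb t := ⟨_, rfl⟩
  rw [← ht] at hrho
  have hbn := H.nb_lt t hrho
  rw [← hb] at hbn
  rw [← ha] at hlt
  refine wp_findSlot hW H (a := a) (b := b) ⟨?_, ?_, ?_, ?_, ?_⟩ ?_ ?_ hlt hbn ?_
  any_goals simp [h0, h1, h2, h3, h4, m0, ← ht, ← ha, ← hb]
  intro s' hm h8 hr
  have ha8 := H.slotOf_div hlt b
  obtain ⟨c, hc⟩ : ∃ c, c = slotOf nb a b := ⟨_, rfl⟩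
  rw [← hc] at h8 ha8
  have hcn : c < 3 * n := by omega
  have hx := H.nb_lt c hcn
  have k1 := P.mk_le (i / 3)
  have k2 := P.mk_le a
  have k3 := P.mk_le b
  simp [contract, wp, Test.Holds, hr, hm, h8, h2, h3, h4, m0, m2, hu]
  -- The tested number is the sum of the three marks and the distance between `nb c` and `b`. It
  -- vanishes exactly when all three vertices are unmarked and `c` closes the triangle.
  refine ⟨by omega, by omega, by omega, by omega, fun h1' h2' h3' h4' h5' => ?_, fun hne => ?_⟩
  · refine ⟨by omega, by omega, by omega, by omega, by omega, by omega, by omega, by omega,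
      by omega, by omega, by omega, by omega, by omega, by omega, by omega, ?_⟩
    have hrot := (P.free i hi h1').2
    rw [← ht] at hrot
    have hrot' := (P.free t hrho (by rwa [hrot, rot_div])).2
    have P' := P.contract H hi rfl ha.symm hrot hb.symm hcn ha8 (by omega : nb c = b) rfl rfl rfl
      hrot' rfl rfl h1' h2' h3' rfl (dead' := fun x =>
        if x = i ∨ x = t ∨ x = op i ∨ x = op t ∨ x = c ∨ x = op c then 1 else s.mem 6 x)
      (fun _ => rfl) (mk' := fun x => if x = i / 3 ∨ x = a ∨ x = b then 1 else s.mem 7 x)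
      (fun _ => rfl)
    have e6 : Function.update (Function.update (Function.update (Function.update (Function.update
        (Function.update (s.mem 6) i 1) t 1) (op i) 1) (op t) 1) c 1) (op c) 1 = fun x =>
        if x = i ∨ x = t ∨ x = op i ∨ x = op t ∨ x = c ∨ x = op c then 1 else s.mem 6 x := by
      ext x
      simp only [Function.update_apply]
      split_ifs <;> first | rfl | (exfalso; tauto)
    have e7 : Function.update (Function.update (Function.update (s.mem 7) (i / 3) 1) a 1) b 1 =
        fun x => if x = i / 3 ∨ x = a ∨ x = b then 1 else s.mem 7 x := by
      ext x
      simp only [Function.update_apply]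
      split_ifs <;> first | rfl | (exfalso; tauto)
    refine ⟨⟨?_, ?_, ?_, ?_, ?_⟩, ?_, ?_, ?_, ?_, ?_, ?_, fun b hb => ?_⟩
    any_goals simp [h0, h1, h2, h3, m0, m2, hr, hm]
    · exact m3
    · exact m4
    · rw [e6, e7]
      convert P' using 4 <;> omega
    · rw [e7]
      refine (M.mono fun x => ?_).succ fun _ => ?_
      · split_ifs
        exacts [P.mk_le x, le_rfl]
      · simp
    · have : b ≠ 5 ∧ b ≠ 6 ∧ b ≠ 7 := by omega
      simp [this, mz b hb]
  · refine ⟨by omega, ⟨?_, ?_, ?_, ?_, ?_⟩, ?_, ?_, ?_, ?_, ?_, ?_, fun b hb => ?_⟩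
    any_goals simp [h0, h1, h2, h3, m0, m2, hr, hm]
    · exact m3
    · exact m4
    · exact P
    · refine M.succ fun hc' hz => ?_
      have hrot := (P.free i hi (by omega)).2
      rw [← ht] at hrot
      rw [← hrot, ← ha, ← hb] at hc' hz
      -- If some arc closes the triangle, the slot lookup has found it, so the test can only have
      -- failed because of a mark.
      obtain ⟨c', hcl, hca, hcb⟩ := hc'
      have := H.slotOf_eq hcl
      rw [hca, hcb, ← hc] at this
      rw [← this] at hcb
      have := hne (by omega) (by omega) (by omega)
      omega
    · exact mz b hb

theorem LinkInv.packing {s : State} (h : LinkInv n nb op n (3 * n) s) :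
    Packing n nb (s.mem 2) (s.mem 5) (s.mem 6) (s.mem 7) := by
  have h6 := h.mem_zero 6 (by norm_num)
  have h7 := h.mem_zero 7 (by norm_num)
  refine ⟨fun s hs => ?_, fun v => ?_, fun s hs _ => ⟨?_, h.mem5 s hs⟩, fun v hv hm => ?_,
    fun s hs _ => ?_⟩
  · rw [h.mem5 s hs]; exact rot_lt hs
  · simp [h7]
  · simp [h6]
  · simp [h7] at hm
  · simp [h6]

theorem pack_reaches (hW : 20 * (n + 1) ≤ W) (H : Arcs n nb op) {s : State}
    (h : LinkInv n nb op n (3 * n) s) :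
    Reaches W pack s (101 * (3 * n) + 10) (PackInv n nb (s.mem 2) (3 * n)) := by
  have H' := H.congr h.mem2
  have h' : Reaches W (.const 4 0) s 1 (PackInv n nb (s.mem 2) 0) := by
    refine (Reaches.of_wp ?_).mono (by decide) fun _ h => h
    have P := h.packing
    obtain ⟨⟨h0, h1, h2, h3, m0⟩, h4, h5, m2, m3, m4, m5, mz⟩ := h
    refine ⟨by omega, ⟨?_, ?_, ?_, ?_, ?_⟩, ?_, ?_, ?_, ?_, ?_, ?_, fun b hb => ?_⟩
    any_goals simp [h0, h1, h2, h3, m0]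
    · intro j hj
      rw [m2 j hj, m3 j hj]
    · intro j hj
      rw [m2 j hj, m4 j hj]
    · exact P
    · intro s hs
      omega
    · exact mz b (by omega)
  refine (h'.seq (T' := 101 * (3 * n) + 2) fun s' h => ?_).mono (by omega) fun _ h => h
  refine (Reaches.loop_lt (T := 100) (N := 3 * n) (fun i => PackInv n nb (s.mem 2) i)
    (fun m s hs => ⟨hs.reg4, hs.reg1⟩) (fun m s hm hs => packSlot_reaches hW H' hm hs) h).seq
    (T' := 1) fun s h => ?_
  exact ⟨1, s, .skip s, le_rfl, h⟩

end RAM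

/-! ### Perfect matchings that avoid an edge in cubic bipartite multigraphs -/

/-- `p` and `q` are inverse bijections between the left slots `L` and the right slots `R` of a cubic
bipartite multigraph, and `rho` rotates the three slots of each vertex. -/
structure Bipartite (rho p q : ℕ → ℕ) (L R : ℕ → Prop) : Prop where
  rhoL : ∀ s, L s → L (rho s)
  rhoR : ∀ s, R s → R (rho s)
  cubeL : ∀ s, L s → rho (rho (rho s)) = s
  cubeR : ∀ s, R s → rho (rho (rho s)) = s
  neL : ∀ s, L s → rho s ≠ s
  neR : ∀ s, R s → rho s ≠ s
  p_mem : ∀ s, L s → R (p s)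
  q_mem : ∀ r, R r → L (q r)
  q_p : ∀ s, L s → q (p s) = s
  p_q : ∀ r, R r → p (q r) = r

/-- `M` is the indicator function of a perfect matching that avoids the edge with right end `z`. -/
structure PerfectAvoiding (rho q : ℕ → ℕ) (L R : ℕ → Prop) (z : ℕ) (M : ℕ → ℕ) : Prop where
  supp : ∀ s, M s ≠ 0 → L s
  left : ∀ s, L s → M s + M (rho s) + M (rho (rho s)) = 1
  right : ∀ r, R r → M (q r) + M (q (rho r)) + M (q (rho (rho r))) = 1
  avoid : R z → M (q z) = 0

theorem PerfectAvoiding.le_one {rho q : ℕ → ℕ} {L R : ℕ → Prop} {z : ℕ} {M : ℕ → ℕ}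
    (h : PerfectAvoiding rho q L R z M) (s : ℕ) : M s ≤ 1 := by
  by_cases hs : M s = 0
  · omega
  · have := h.left s (h.supp s hs)
    omega

section Reduction

variable {rho p q : ℕ → ℕ} {L R : ℕ → Prop} {z e f g r r₁ r₂ a₁ a₂ b₂ : ℕ}

/-- The two ends `u` and `v` of an edge are deleted. The slots of `u` are `e`, `f`, `g`, those of `v`
are `r`, `r₁`, `r₂`, and the edge joins `f` to `r`. -/
structure Deletion (rho p q : ℕ → ℕ) (L R : ℕ → Prop) (z e f g r r₁ r₂ a₁ a₂ b₂ : ℕ) : Prop where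
  he : e = q z
  hf : f = rho e
  hg : g = rho f
  hr : r = p f
  hr₁₂ : (r₁ = rho r ∧ r₂ = rho r₁) ∨ (r₂ = rho r ∧ r₁ = rho r₂)
  ne_z : r₂ ≠ z
  ne_b : r₁ ≠ b₂
  ha₁ : a₁ = q r₁
  ha₂ : a₂ = q r₂
  hb₂ : b₂ = p g

structure DeletionFacts (rho p q : ℕ → ℕ) (L R : ℕ → Prop) (z e f g r r₁ r₂ a₁ a₂ b₂ : ℕ) :
    Prop where
  Le : L e
  Lf : L f
  Lg : L g
  Rr : R r
  Rr₁ : R r₁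
  Rr₂ : R r₂
  Rb : R b₂
  ef : e ≠ f
  fg : f ≠ g
  ge : g ≠ e
  rr₁ : r ≠ r₁
  r₁r₂ : r₁ ≠ r₂
  r₂r : r₂ ≠ r
  bz : b₂ ≠ z
  br : b₂ ≠ r
  zr : z ≠ r
  pe : p e = z
  qr : q r = f
  qb : q b₂ = g
  L_of : ∀ s, L s → s = e ∨ s = f ∨ s = g ∨
    ((s ≠ e ∧ s ≠ f ∧ s ≠ g) ∧ (rho s ≠ e ∧ rho s ≠ f ∧ rho s ≠ g))
  R_of : ∀ s, R s → s = r ∨ s = r₁ ∨ s = r₂ ∨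
    ((s ≠ r ∧ s ≠ r₁ ∧ s ≠ r₂) ∧ (rho s ≠ r ∧ rho s ≠ r₁ ∧ rho s ≠ r₂))

theorem Bipartite.deletionFacts (B : Bipartite rho p q L R) (hz : R z)
    (D : Deletion rho p q L R z e f g r r₁ r₂ a₁ a₂ b₂) :
    DeletionFacts rho p q L R z e f g r r₁ r₂ a₁ a₂ b₂ := by
  obtain ⟨he, hf, hg, hr, hr₁₂, ne_z, ne_b, ha₁, ha₂, hb₂⟩ := D
  have Le : L e := he ▸ B.q_mem z hz
  have Lf : L f := hf ▸ B.rhoL e Le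
  have Lg : L g := hg ▸ B.rhoL f Lf
  have re : rho g = e := by rw [hg, hf]; exact B.cubeL e Le
  have Rr : R r := hr ▸ B.p_mem f Lf
  have ef : e ≠ f := hf ▸ (B.neL e Le).symm
  have fg : f ≠ g := hg ▸ (B.neL f Lf).symm
  have ge : g ≠ e := fun h => B.neL g Lg (re.trans h.symm)
  have pe : p e = z := by rw [he]; exact B.p_q z hz
  have qr : q r = f := by rw [hr]; exact B.q_p f Lf
  have qb : q b₂ = g := by rw [hb₂]; exact B.q_p g Lg
  have Rs := B.rhoR r Rr
  have Rt := B.rhoR _ Rs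
  have h3 := B.cubeR r Rr
  have n1 := B.neR r Rr
  have n2 := B.neR _ Rs
  have n3 := B.neR _ Rt
  rw [h3] at n3
  have R_of : ∀ s, R s → s = r ∨ s = rho r ∨ s = rho (rho r) ∨
      ((s ≠ r ∧ s ≠ rho r ∧ s ≠ rho (rho r)) ∧
        (rho s ≠ r ∧ rho s ≠ rho r ∧ rho s ≠ rho (rho r))) := by
    intro s hs
    have := B.cubeR s hs
    grind
  refine ⟨Le, Lf, Lg, Rr, ?_, ?_, hb₂ ▸ B.p_mem g Lg, ef, fg, ge, ?_, ?_, ?_, ?_, ?_, ?_, pe, qr, qb,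
    ?_, ?_⟩
  · rcases hr₁₂ with ⟨h1, h2⟩ | ⟨h1, h2⟩ <;> grind
  · rcases hr₁₂ with ⟨h1, h2⟩ | ⟨h1, h2⟩ <;> grind
  · rcases hr₁₂ with ⟨h1, h2⟩ | ⟨h1, h2⟩ <;> grind
  · rcases hr₁₂ with ⟨h1, h2⟩ | ⟨h1, h2⟩ <;> grind
  · rcases hr₁₂ with ⟨h1, h2⟩ | ⟨h1, h2⟩ <;> grind
  · rintro rfl; exact ge (qb.symm.trans he.symm)
  · rintro rfl; exact fg (qr.symm.trans qb)
  · rintro rfl; exact ef (he.trans qr)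
  · intro s hs
    have := B.cubeL s hs
    grind
  · intro s hs
    have := R_of s hs
    rcases hr₁₂ with ⟨h1, h2⟩ | ⟨h1, h2⟩ <;> grind

/-- The loose ends are `a₁`, `a₂` on the left and `z`, `b₂` on the right; the new edges are `a₁z`
and `a₂b₂`. The conditions `ne_z` and `ne_b` take care of parallel edges: if `e` is parallel to `f`,
then `z = r₁` and `a₁ = e`, so the would-be edge `a₁z` lies among the deleted slots. If `g` is
parallel to `f`, then `b₂ = r₂` and `a₂ = g`, and the same happens to `a₂b₂`. -/
theorem Bipartite.delete (B : Bipartite rho p q L R) (hz : R z) (D : Deletion rho p q L R z e f g r r₁ r₂ a₁ a₂ b₂) {L' R' : ℕ → Prop} {p' q' : ℕ → ℕ}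
    (hp' : p' = Function.update (Function.update p a₁ z) a₂ b₂)
    (hq' : q' = Function.update (Function.update q z a₁) b₂ a₂)
    (hL' : ∀ s, L' s ↔ L s ∧ s ≠ e ∧ s ≠ f ∧ s ≠ g)
    (hR' : ∀ s, R' s ↔ R s ∧ s ≠ r ∧ s ≠ r₁ ∧ s ≠ r₂) :
    Bipartite rho p' q' L' R' := by
  have F := B.deletionFacts hz D
  obtain ⟨he, hf, hg, hr, hr₁₂, ne_z, ne_b, ha₁, ha₂, hb₂⟩ := D
  obtain ⟨Le, Lf, Lg, Rr, Rr₁, Rr₂, Rb, ef, fg, ge, rr₁, r₁r₂, r₂r, bz, br, zr, pe, qr, qb, L_of,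
    R_of⟩ := F
  have p1 : p a₁ = r₁ := by rw [ha₁]; exact B.p_q r₁ Rr₁
  have p2 : p a₂ = r₂ := by rw [ha₂]; exact B.p_q r₂ Rr₂
  have a₁₂ : a₁ ≠ a₂ := by rintro h; rw [h] at p1; exact r₁r₂ (p1.symm.trans p2)
  have L₁ : L a₁ := ha₁ ▸ B.q_mem r₁ Rr₁
  have L₂ : L a₂ := ha₂ ▸ B.q_mem r₂ Rr₂
  refine ⟨?_, ?_, ?_, ?_, ?_, ?_, ?_, ?_, ?_, ?_⟩
  · intro s hs
    have := L_of s ((hL' s).1 hs).1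
    have := B.rhoL s ((hL' s).1 hs).1
    grind
  · intro s hs
    have := R_of s ((hR' s).1 hs).1
    have := B.rhoR s ((hR' s).1 hs).1
    grind
  · exact fun s hs => B.cubeL s ((hL' s).1 hs).1
  · exact fun s hs => B.cubeR s ((hR' s).1 hs).1
  · exact fun s hs => B.neL s ((hL' s).1 hs).1
  · exact fun s hs => B.neR s ((hR' s).1 hs).1
  · intro s hs
    obtain ⟨Ls, hse, hsf, hsg⟩ := (hL' s).1 hs
    have h1 := B.p_mem s Ls
    have h2 := B.q_p s Ls
    rw [hR', hp']
    simp only [Function.update_apply]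
    split_ifs <;> grind
  · intro s hs
    obtain ⟨Rs, hse, hsf, hsg⟩ := (hR' s).1 hs
    have h1 := B.q_mem s Rs
    have h2 := B.p_q s Rs
    rw [hL', hq']
    simp only [Function.update_apply]
    split_ifs <;> grind
  · intro s hs
    obtain ⟨Ls, hse, hsf, hsg⟩ := (hL' s).1 hs
    have h1 := B.p_mem s Ls
    have h2 := B.q_p s Ls
    rw [hp', hq']
    simp only [Function.update_apply]
    split_ifs <;> grind
  · intro s hs
    obtain ⟨Rs, hse, hsf, hsg⟩ := (hR' s).1 hs
    have h1 := B.q_mem s Rs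
    have h2 := B.p_q s Rs
    rw [hp', hq']
    simp only [Function.update_apply]
    split_ifs <;> grind

/-- If `a₂b₂` is unused, `f` covers both deleted vertices. If it is used, the value at `a₂` is
reread as the old edge from `a₂` to `r₂`, which covers `v`, and `g` covers `u` and the vertex of
`b₂`. Since `a₁z` is avoided, neither `e` nor the old edge from `a₁` to `r₁` is called for. -/
theorem PerfectAvoiding.of_delete (B : Bipartite rho p q L R) (hz : R z) (D : Deletion rho p q L R z e f g r r₁ r₂ a₁ a₂ b₂) {L' R' : ℕ → Prop} {q' : ℕ → ℕ}
    (hq' : q' = Function.update (Function.update q z a₁) b₂ a₂)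
    (hL' : ∀ s, L' s ↔ L s ∧ s ≠ e ∧ s ≠ f ∧ s ≠ g)
    (hR' : ∀ s, R' s ↔ R s ∧ s ≠ r ∧ s ≠ r₁ ∧ s ≠ r₂) {M : ℕ → ℕ}
    (h : PerfectAvoiding rho q' L' R' z M) :
    PerfectAvoiding rho q L R z (Function.update M (if M a₂ = 0 then f else g) 1) := by
  have F := B.deletionFacts hz D
  have hle := h.le_one
  obtain ⟨he, hf, hg, hr, hr₁₂, ne_z, ne_b, ha₁, ha₂, hb₂⟩ := D
  obtain ⟨Le, Lf, Lg, Rr, Rr₁, Rr₂, Rb, ef, fg, ge, rr₁, r₁r₂, r₂r, bz, br, zr, pe, qr, qb, L_of,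
    R_of⟩ := F
  have p1 : p a₁ = r₁ := by rw [ha₁]; exact B.p_q r₁ Rr₁
  have p2 : p a₂ = r₂ := by rw [ha₂]; exact B.p_q r₂ Rr₂
  have Me : M e = 0 := by_contra fun h' => ((hL' e).1 (h.supp e h')).2.1 rfl
  have Mf : M f = 0 := by_contra fun h' => ((hL' f).1 (h.supp f h')).2.2.1 rfl
  have Mg : M g = 0 := by_contra fun h' => ((hL' g).1 (h.supp g h')).2.2.2 rfl
  obtain ⟨x, hx⟩ : ∃ x, x = if M a₂ = 0 then f else g := ⟨_, rfl⟩
  rw [← hx]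
  have hxe : x ≠ e := by rw [hx]; split_ifs <;> grind
  obtain ⟨N, hN⟩ : ∃ N, N = Function.update M x 1 := ⟨_, rfl⟩
  rw [← hN]
  have Nne : ∀ s, s ≠ f → s ≠ g → N s = M s := by
    intro s h1 h2
    rw [hN, Function.update_of_ne]
    rw [hx]
    split_ifs <;> assumption
  -- Surviving right slots see the same values through the old and the new edges: at `b₂` the value
  -- of `g` is that of `a₂`, and at `z` both values are 0.
  have Nq : ∀ u, R' u → N (q u) = M (q' u) := by
    intro u hu
    obtain ⟨Ru, h1, h2, h3⟩ := (hR' u).1 hu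
    have h4 := B.p_q u Ru
    rw [hq']
    simp only [Function.update_apply]
    split_ifs with h5 h6
    · rw [h5, qb, hN, Function.update_apply, hx]
      have := hle a₂
      split_ifs with h7 h8 h8
      · exact absurd h8.symm fg
      · omega
      · omega
      · omega
    · have := h.avoid (h6 ▸ hu)
      rw [hq', Function.update_of_ne bz.symm, Function.update_self] at this
      rw [this, h6, ← he, Nne e ef ge.symm, Me]
    · apply Nne <;> grind
  -- At `v`, the edge at `r₁` is unused because `a₁z` was avoided (or because `a₁` is `e`), and
  -- exactly one of `f` and `a₂` is chosen.
  have Nr : N (q r) + N (q r₁) + N (q r₂) = 1 := by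
    rw [qr, ← ha₁, ← ha₂]
    have h1 : N a₁ = 0 := by
      by_cases h' : r₁ = z
      · rw [ha₁, h', ← he, Nne e ef ge.symm, Me]
      · have Rz' : R' z := (hR' z).2 ⟨hz, zr, Ne.symm h', ne_z.symm⟩
        have := h.avoid Rz'
        rw [hq', Function.update_of_ne bz.symm, Function.update_self] at this
        rw [Nne a₁ ?_ ?_, this]
        · rintro h'; rw [h'] at p1; exact rr₁ (hr.trans p1)
        · rintro h'; rw [h'] at p1; exact ne_b (p1.symm.trans hb₂.symm)
    have h2 : a₂ ≠ f := by rintro h'; rw [h'] at p2; exact r₂r (p2.symm.trans hr.symm)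
    rw [h1, hN]
    have := hle a₂
    simp only [Function.update_apply, hx]
    split_ifs <;> grind
  refine ⟨?_, ?_, ?_, ?_⟩
  · intro s hs
    rw [hN, Function.update_apply] at hs
    split_ifs at hs with h'
    · rw [h', hx]
      split_ifs <;> assumption
    · exact ((hL' s).1 (h.supp s hs)).1
  · have key : N e + N f + N g = 1 := by
      rw [Nne e ef ge.symm, Me, hN]
      simp only [Function.update_apply, hx]
      split_ifs <;> grind
    have hge : rho g = e := by rw [hg, hf]; exact B.cubeL e Le
    intro s hs
    rcases L_of s hs with rfl | rfl | rfl | ⟨h1, h2⟩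
    · rw [← hf, ← hg]; omega
    · rw [← hg, hge]; omega
    · rw [hge, ← hf]; omega
    · have h3 : L' (rho s) := (hL' _).2 ⟨B.rhoL s hs, h2⟩
      have h4 := L_of _ (B.rhoL s hs)
      have h5 : rho (rho s) ≠ e ∧ rho (rho s) ≠ f ∧ rho (rho s) ≠ g := by
        rcases h4 with h4 | h4 | h4 | h4
        · exact absurd h4 h2.1
        · exact absurd h4 h2.2.1
        · exact absurd h4 h2.2.2
        · exact h4.2
      rw [Nne s h1.2.1 h1.2.2, Nne _ h2.2.1 h2.2.2, Nne _ h5.2.1 h5.2.2]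
      exact h.left s ((hL' s).2 ⟨hs, h1⟩)
  · have h3 := B.cubeR r Rr
    intro s hs
    have main : s = r ∨ s = r₁ ∨ s = r₂ → N (q s) + N (q (rho s)) + N (q (rho (rho s))) = 1 := by
      rcases hr₁₂ with ⟨h1, h2⟩ | ⟨h1, h2⟩
      · have h4 : rho r₂ = r := by rw [h2, h1, h3]
        rintro (rfl | rfl | rfl)
        · rw [← h1, ← h2]; omega
        · rw [← h2, h4]; omega
        · rw [h4, ← h1]; omega
      · have h4 : rho r₁ = r := by rw [h2, h1, h3]
        rintro (rfl | rfl | rfl)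
        · rw [← h1, ← h2]; omega
        · rw [h4, ← h1]; omega
        · rw [← h2, h4]; omega
    rcases R_of s hs with h1 | h1 | h1 | ⟨h1, h2⟩
    · exact main (Or.inl h1)
    · exact main (Or.inr (Or.inl h1))
    · exact main (Or.inr (Or.inr h1))
    · have h5 : rho (rho s) ≠ r ∧ rho (rho s) ≠ r₁ ∧ rho (rho s) ≠ r₂ := by
        rcases R_of _ (B.rhoR s hs) with h4 | h4 | h4 | h4
        · exact absurd h4 h2.1
        · exact absurd h4 h2.2.1
        · exact absurd h4 h2.2.2
        · exact h4.2
      have R1 := B.rhoR s hs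
      rw [Nq s ((hR' s).2 ⟨hs, h1⟩), Nq _ ((hR' _).2 ⟨R1, h2⟩),
        Nq _ ((hR' _).2 ⟨B.rhoR _ R1, h5⟩)]
      exact h.right s ((hR' s).2 ⟨hs, h1⟩)
  · intro _
    rw [← he, Nne e ef ge.symm, Me]

end Reduction

/-- Undoes the last `k` deletions: extends a perfect matching of the reduced graph. -/
def undo (rho A F : ℕ → ℕ) : ℕ → (ℕ → ℕ) → ℕ → ℕ
  | 0, M => M
  | k + 1, M => undo rho A F k (Function.update M (if M (A k) = 0 then F k else rho (F k)) 1)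

/-- The log is a stack: writing the entry of a new deletion does not affect the unwinding of the
earlier ones. -/
theorem undo_congr {rho A F A' F' : ℕ → ℕ} {k : ℕ} (hA : ∀ j < k, A' j = A j)
    (hF : ∀ j < k, F' j = F j) (M : ℕ → ℕ) : undo rho A' F' k M = undo rho A F k M := by
  induction k generalizing M with
  | zero => rfl
  | succ k ih =>
    rw [undo, undo, hA k (by omega), hF k (by omega)]
    exact ih (fun j hj => hA j (by omega)) (fun j hj => hF j (by omega)) _

/-- The slots below `3 * n` that are not dead. -/
def Live (n : ℕ) (dead : ℕ → ℕ) (s : ℕ) : Prop := s < 3 * n ∧ dead s = 0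

/-- The number of live slots. -/
def liveCard (n : ℕ) (dead : ℕ → ℕ) : ℕ := ((Finset.range (3 * n)).filter (dead · = 0)).card

theorem liveCard_le (n : ℕ) (dead : ℕ → ℕ) : liveCard n dead ≤ 3 * n :=
  (Finset.card_filter_le _ _).trans (Finset.card_range _).le

theorem liveCard_lt {n r : ℕ} {dead dead' : ℕ → ℕ} (hr : Live n dead r) (hr' : dead' r ≠ 0)
    (h : ∀ s, dead' s = 0 → dead s = 0) : liveCard n dead' < liveCard n dead := by
  apply Finset.card_lt_card
  rw [Finset.ssubset_iff_of_subset]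
  · exact ⟨r, by simpa [Live] using hr, by simp [hr']⟩
  · intro s hs
    simp only [Finset.mem_filter] at hs ⊢
    exact ⟨hs.1, h s hs.2⟩

/-- Once slot `z` is deleted, no edge ends there and avoiding it is no condition. This lets the
pointer to the avoided edge move on to the next slot. -/
theorem PerfectAvoiding.of_not {rho q : ℕ → ℕ} {L R : ℕ → Prop} {z z' : ℕ} {M : ℕ → ℕ}
    (h : PerfectAvoiding rho q L R z' M) (hz : ¬ R z) : PerfectAvoiding rho q L R z M :=
  ⟨h.supp, h.left, h.right, fun h' => absurd h' hz⟩

/-! ### The matching algorithm: deletions and their undoing -/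

namespace RAM

variable {n W : ℕ} {nb op : ℕ → ℕ}

/-- The second half of a deletion, with the slots of the deleted vertices in registers. -/
def splice : Prog :=
  block [.load 16 4 14, .load 17 4 15, .store 3 16 4, .store 4 4 16, .store 3 17 13, .store 4 13 17,
    .store 6 10 3, .store 6 14 3, .store 6 15 3, .store 8 5 17, .store 9 5 8, .add 5 5 3]

def deleteEdge : Prog :=
  block [.load 7 4 4, .load 8 5 7, .load 9 5 8, .load 10 3 8, .load 11 5 10, .load 12 5 11,
    .load 13 3 9,
    .branch (.eq 4 12) (block [.move 14 12, .move 15 11])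
      (.branch (.eq 13 11) (block [.move 14 12, .move 15 11]) (block [.move 14 11, .move 15 12])),
    splice]

def reduceSlot : Prog :=
  block [.load 6 6 4, .branch (.eq 6 2) deleteEdge (.add 4 4 3)]

/-- Banks 3 and 4 hold `p` and `q`, bank 6 the dead right slots, banks 8 and 9 the log. The set of
left slots is only asserted to exist, as the program never tests whether a left slot is present.
`Final` stands for the desired property in the original graph, so that intermediate graphs need not
be remembered. -/
structure ReduceInv (n : ℕ) (nb op rho : ℕ → ℕ) (Final : (ℕ → ℕ) → Prop) (z k : ℕ) (s : State) :
    Prop extends Frame n nb s where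
  reg4 : s.reg 4 = z
  reg5 : s.reg 5 = k
  mem2 : s.mem 2 = op
  mem5 : s.mem 5 = rho
  z_le : z ≤ 3 * n
  k_le : k + liveCard n (s.mem 6) ≤ 3 * n
  dead : ∀ j < z, s.mem 6 j ≠ 0
  graph : ∃ L, Bipartite rho (s.mem 3) (s.mem 4) L (Live n (s.mem 6)) ∧
    ∀ M, PerfectAvoiding rho (s.mem 4) L (Live n (s.mem 6)) z M →
      Final (undo rho (s.mem 8) (s.mem 9) k M)
  mem_zero : ∀ b, b = 1 ∨ 9 < b → s.mem b = 0

variable {rho : ℕ → ℕ} {Final : (ℕ → ℕ) → Prop}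

theorem wp_splice (hW : 20 * (n + 1) ≤ W) {z k : ℕ} {s s' : State} (hz : Live n (s.mem 6) z)
    (h : ReduceInv n nb op rho Final z k s) {r r₁ r₂ b : ℕ}
    (hm : s'.mem = s.mem) (hreg : ∀ i < 6, s'.reg i = s.reg i)
    (h8 : s'.reg 8 = rho (s.mem 4 z)) (h10 : s'.reg 10 = r) (h13 : s'.reg 13 = b)
    (h14 : s'.reg 14 = r₁) (h15 : s'.reg 15 = r₂)
    (hr : r = s.mem 3 (rho (s.mem 4 z))) (hb : b = s.mem 3 (rho (rho (s.mem 4 z))))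
    (hr₁₂ : (r₁ = rho r ∧ r₂ = rho r₁) ∨ (r₂ = rho r ∧ r₁ = rho r₂))
    (ne_z : r₂ ≠ z) (ne_b : r₁ ≠ b) :
    wp W splice (fun s'' => ReduceInv n nb op rho Final z (k + 1) s'' ∧
      liveCard n (s''.mem 6) < liveCard n (s.mem 6)) s' := by
  obtain ⟨⟨h0, h1, h2, h3, m0⟩, h4, h5, m2, m5, hzl, hk, hd, ⟨L, B, hM⟩, mz⟩ := h
  have D : Deletion rho (s.mem 3) (s.mem 4) L (Live n (s.mem 6)) z _ _ _ r r₁ r₂ _ _ b :=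
    ⟨rfl, rfl, rfl, hr, hr₁₂, ne_z, ne_b, rfl, rfl, hb⟩
  have F := B.deletionFacts hz D
  have hzn := hz.1
  obtain ⟨dead', hdead'⟩ : ∃ d, d = Function.update (Function.update
    (Function.update (s.mem 6) r 1) r₁ 1) r₂ 1 := ⟨_, rfl⟩
  have hdd : ∀ x, dead' x = 0 ↔ s.mem 6 x = 0 ∧ x ≠ r ∧ x ≠ r₁ ∧ x ≠ r₂ := by
    intro x
    rw [hdead']
    simp only [Function.update_apply]
    split_ifs <;> simp_all
  have hlt : liveCard n dead' < liveCard n (s.mem 6) :=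
    liveCard_lt F.Rr (by rw [Ne, hdd]; tauto) fun x hx => ((hdd x).1 hx).1
  have hk' : k + 1 ≤ W := by omega
  simp [splice, wp, hm, hreg, h3, h4, h5, h8, h10, h13, h14, h15, hk', ← hdead']
  refine ⟨⟨⟨?_, ?_, ?_, ?_, ?_⟩, ?_, ?_, ?_, ?_, ?_, ?_, ?_, ?_, fun b hb => ?_⟩, hlt⟩
  any_goals simp [hm, hreg, h0, h1, h2, h3, h4, m0, m2, m5, ← hdead']
  · exact hzl
  · omega
  · intro j hj hj'
    exact hd j hj ((hdd j).1 hj').1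
  · refine ⟨fun x => L x ∧ x ≠ s.mem 4 z ∧ x ≠ rho (s.mem 4 z) ∧ x ≠ rho (rho (s.mem 4 z)),
      B.delete hz D rfl rfl (fun _ => Iff.rfl) fun x => by simp only [Live, hdd]; tauto, ?_⟩
    intro M hM'
    have := hM _ (PerfectAvoiding.of_delete B hz D rfl (fun _ => Iff.rfl)
      (fun x => by simp only [Live, hdd]; tauto) hM')
    rw [undo, Function.update_self, Function.update_self]
    rwa [undo_congr (fun j hj => Function.update_of_ne hj.ne _ _)
      (fun j hj => Function.update_of_ne hj.ne _ _)]
  · have : b ≠ 3 ∧ b ≠ 4 ∧ b ≠ 6 ∧ b ≠ 8 ∧ b ≠ 9 := by omega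
    simp [this, mz b hb]

theorem deleteEdge_reaches (hW : 20 * (n + 1) ≤ W) {z k : ℕ} {s : State}
    (hz : Live n (s.mem 6) z) (h : ReduceInv n nb op rho Final z k s) :
    Reaches W deleteEdge s 40 (fun s' => ReduceInv n nb op rho Final z (k + 1) s' ∧
      liveCard n (s'.mem 6) < liveCard n (s.mem 6)) := by
  refine (Reaches.of_wp ?_).mono (by decide) fun _ h => h
  have h' := h
  obtain ⟨⟨h0, h1, h2, h3, m0⟩, h4, h5, m2, m5, hzl, hk, hd, ⟨L, B, hM⟩, mz⟩ := h'
  obtain ⟨r, hr⟩ : ∃ r, r = s.mem 3 (rho (s.mem 4 z)) := ⟨_, rfl⟩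
  obtain ⟨b, hb⟩ : ∃ b, b = s.mem 3 (rho (rho (s.mem 4 z))) := ⟨_, rfl⟩
  have Le := B.q_mem z hz
  have Lf := B.rhoL _ Le
  have Rr := B.p_mem _ Lf
  rw [← hr] at Rr
  have bz : b ≠ z := by
    rintro rfl
    have := B.q_p _ (B.rhoL _ Lf)
    rw [← hb] at this
    have h3 := B.cubeL _ Le
    rw [← this] at h3
    exact B.neL _ Le h3
  have n1 := B.neR _ (B.rhoR _ Rr)
  have h6 : ∀ i < 6, i ≠ 7 ∧ i ≠ 8 ∧ i ≠ 9 ∧ i ≠ 10 ∧ i ≠ 11 ∧ i ≠ 12 ∧ i ≠ 13 ∧ i ≠ 14 ∧ i ≠ 15 := by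
    omega
  simp only [deleteEdge, wp_block_cons, wp_block_nil, wp, Test.Holds]
  simp [h4, m5, ← hr, ← hb]
  -- The slot `r₂` must differ from `z` and `r₁` from `b`. As `z ≠ b` and the two slots are
  -- distinct, one of their two orders is always admissible.
  refine ⟨fun hc => ?_, fun hc => ⟨fun hc' => ?_, fun hc' => ?_⟩⟩
  · refine wp_splice hW hz h (r₁ := rho (rho r)) (r₂ := rho r) ?_ ?_ ?_ ?_ ?_ ?_ ?_ hr hb
      (Or.inr ⟨rfl, rfl⟩) ?_ ?_
    any_goals simp
    · intro i hi
      simp [h6 i hi]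
    · exact fun h' => n1 (hc.symm.trans h'.symm)
    · exact fun h' => bz (h'.symm.trans hc.symm)
  · refine wp_splice hW hz h (r₁ := rho (rho r)) (r₂ := rho r) ?_ ?_ ?_ ?_ ?_ ?_ ?_ hr hb
      (Or.inr ⟨rfl, rfl⟩) ?_ ?_
    any_goals simp
    · intro i hi
      simp [h6 i hi]
    · exact fun h' => bz (hc'.trans h')
    · exact fun h' => n1 (h'.trans hc')
  · refine wp_splice hW hz h (r₁ := rho r) (r₂ := rho (rho r)) ?_ ?_ ?_ ?_ ?_ ?_ ?_ hr hb
      (Or.inl ⟨rfl, rfl⟩) ?_ ?_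
    any_goals simp
    · intro i hi
      simp [h6 i hi]
    · exact fun h' => hc h'.symm
    · exact fun h' => hc' h'.symm

theorem ReduceInv.setReg {z z' k : ℕ} {s : State} (h : ReduceInv n nb op rho Final z k s) {i w : ℕ}
    (hi : 5 < i) (hz' : z' = z) : ReduceInv n nb op rho Final z' k (s.setReg i w) := by
  subst hz'
  obtain ⟨⟨h0, h1, h2, h3, m0⟩, h4, h5, m2, m5, hzl, hk, hd, hg, mz⟩ := h
  have : 0 ≠ i ∧ 1 ≠ i ∧ 2 ≠ i ∧ 3 ≠ i ∧ 4 ≠ i ∧ 5 ≠ i := by omega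
  refine ⟨⟨?_, ?_, ?_, ?_, m0⟩, ?_, ?_, m2, m5, hzl, hk, hd, hg, mz⟩ <;> simp [*]

theorem ReduceInv.skip {z k : ℕ} {s : State} (h : ReduceInv n nb op rho Final z k s)
    (hz : z < 3 * n) (hd : s.mem 6 z ≠ 0) :
    ReduceInv n nb op rho Final (z + 1) k (s.setReg 4 (z + 1)) := by
  obtain ⟨⟨h0, h1, h2, h3, m0⟩, h4, h5, m2, m5, hzl, hk, hdead, ⟨L, B, hM⟩, mz⟩ := h
  refine ⟨⟨by simpa, by simpa, by simpa, by simpa, m0⟩, by simp, by simpa, m2, m5, hz, hk, ?_,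
    ⟨L, B, fun M hM' => hM M (hM'.of_not fun h => hd h.2)⟩, mz⟩
  intro j hj
  obtain hj | rfl : j < z ∨ j = z := by omega
  · exact hdead j hj
  · exact hd

/-- A deletion keeps the pointer and lowers the number of live slots; at a dead slot the pointer
advances. Hence the sum of the two terms falls in every round. -/
theorem reduceSlot_reaches (hW : 20 * (n + 1) ≤ W) {z k : ℕ} {s : State} (hz : z < 3 * n)
    (h : ReduceInv n nb op rho Final z k s) :
    Reaches W reduceSlot s 50 (fun s' => ∃ z' k', ReduceInv n nb op rho Final z' k' s' ∧
      (3 * n - z') + liveCard n (s'.mem 6) < (3 * n - z) + liveCard n (s.mem 6)) := by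
  have h1 : Reaches W (.load 6 6 4) s 1 (fun s' => s' = s.setReg 6 (s.mem 6 z)) := by
    refine Reaches.of_wp ?_
    simp [wp, h.reg4]
  refine (h1.seq (T' := 49) fun s' hs' => ?_).mono (by omega) fun _ h => h
  have h' : ReduceInv n nb op rho Final z k s' := hs' ▸ h.setReg (by omega) rfl
  have hm : s'.mem = s.mem := by rw [hs']; rfl
  have h6 : s'.reg 6 = s.mem 6 z := by rw [hs']; simp
  refine Reaches.seq (T := 41) (T' := 1) (Reaches.branch (fun hc => ?_) fun hc => ?_)
    (fun s hs => ⟨1, s, .skip s, le_rfl, hs⟩) |>.mono (by omega) fun _ h => h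
  · simp only [Test.Holds, h6, h'.reg2] at hc
    refine (deleteEdge_reaches hW ⟨hz, by rwa [hm]⟩ h').mono le_rfl fun s'' hs => ⟨z, _, hs.1, ?_⟩
    have := hs.2
    rw [hm] at this
    omega
  · simp only [Test.Holds, h6, h'.reg2] at hc
    refine (Reaches.of_wp ?_).mono (by decide) fun _ h => h
    simp only [wp, h'.reg4, h'.reg3]
    refine ⟨by omega, z + 1, k, h'.skip hz (by rwa [hm]), ?_⟩
    rw [State.setReg_mem, hm]
    omega

/-- Takes one deletion back. -/
def undoStep : Prog :=
  block [.sub 5 5 3, .load 6 8 5, .load 7 9 5, .load 8 10 6, .branch (.eq 8 2) .skip (.load 7 5 7),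
    .store 10 7 3]

/-- Finds a perfect matching in the double cover. -/
def perfectMatching : Prog :=
  block [.const 4 0, .const 5 0, .loop (.lt 4 1) reduceSlot, .loop (.lt 2 5) undoStep]

structure UndoInv (n : ℕ) (nb op rho : ℕ → ℕ) (Final : (ℕ → ℕ) → Prop) (k : ℕ) (s : State) :
    Prop extends Frame n nb s where
  reg5 : s.reg 5 = k
  mem2 : s.mem 2 = op
  mem5 : s.mem 5 = rho
  final : Final (undo rho (s.mem 8) (s.mem 9) k (s.mem 10))
  mem_zero : ∀ b, b = 1 ∨ 10 < b → s.mem b = 0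

/-- When the pointer has passed all slots, no right slot is left, hence no left slot either, and the
zero function in the untouched bank 10 is a perfect matching. -/
theorem ReduceInv.undoInv {k : ℕ} {s : State}
    (h : ReduceInv n nb op rho Final (3 * n) k s) : UndoInv n nb op rho Final k s := by
  obtain ⟨h0, h4, h5, m2, m5, hzl, hk, hdead, ⟨L, B, hM⟩, mz⟩ := h
  refine ⟨h0, h5, m2, m5, hM _ ?_, fun b hb => mz b (by omega)⟩
  have hR : ∀ r, ¬ Live n (s.mem 6) r := fun r hr => hdead r hr.1 hr.2
  refine ⟨fun s' hs' => ?_, fun s' hs' => absurd (B.p_mem s' hs') (hR _),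
    fun r hr => absurd hr (hR r), fun hz => absurd hz (hR _)⟩
  simp [mz 10 (by omega)] at hs'

theorem undoStep_reaches {k : ℕ} {s : State} (h : UndoInv n nb op rho Final (k + 1) s) :
    Reaches W undoStep s 10 (UndoInv n nb op rho Final k) := by
  obtain ⟨⟨h0, h1, h2, h3, m0⟩, h5, m2, m5, hF, mz⟩ := h
  refine (Reaches.of_wp (Q := UndoInv n nb op rho Final k) ?_).mono (by decide) fun _ h => h
  simp [undoStep, wp, Test.Holds, h2, h3, h5, m5]
  rw [undo] at hF
  refine ⟨fun hc => ?_, fun hc => ?_⟩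
  · rw [if_pos hc] at hF
    refine ⟨⟨?_, ?_, ?_, ?_, ?_⟩, ?_, ?_, ?_, ?_, fun b hb => ?_⟩
    any_goals simp [h0, h1, h2, h3, m0, m2, m5]
    · exact hF
    · have : b ≠ 10 := by omega
      simp [this, mz b hb]
  · rw [if_neg hc] at hF
    refine ⟨⟨?_, ?_, ?_, ?_, ?_⟩, ?_, ?_, ?_, ?_, fun b hb => ?_⟩
    any_goals simp [h0, h1, h2, h3, m0, m2, m5]
    · exact hF
    · have : b ≠ 10 := by omega
      simp [this, mz b hb]

theorem perfectMatching_reaches (hW : 20 * (n + 1) ≤ W) {s : State}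
    (h : ReduceInv n nb op rho Final 0 0 ((s.setReg 4 0).setReg 5 0)) :
    Reaches W perfectMatching s (500 * (n + 1)) (UndoInv n nb op rho Final 0) := by
  have h' : Reaches W (.const 4 0) s 1 fun s' =>
      ReduceInv n nb op rho Final 0 0 (s'.setReg 5 0) := Reaches.of_wp ⟨by omega, h⟩
  refine (h'.seq (T' := 500 * n + 499) fun s' h => ?_).mono (by omega) fun _ h => h
  have h' : Reaches W (.const 5 0) s' 1 fun s' =>
      ReduceInv n nb op rho Final 0 0 s' := Reaches.of_wp ⟨by omega, h⟩
  refine (h'.seq (T' := 500 * n + 498) fun s h => ?_).mono (by omega) fun _ h => h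
  have hl : Reaches W (.loop (.lt 4 1) reduceSlot) s (51 * (6 * n) + 1) fun s =>
      ∃ k, k ≤ 3 * n ∧ UndoInv n nb op rho Final k s := by
    -- A round costs at most 50 steps and a test. Both terms of the potential are at most `3 * n` at
    -- the start, whence the factor `6 * n`.
    obtain ⟨k', hk', hr⟩ := Reaches.loop (W := W) (c := .lt 4 1) (p := reduceSlot)
      (fun m s => ∃ z k, m = 51 * (3 * n - z + liveCard n (s.mem 6)) ∧
        ReduceInv n nb op rho Final z k s)
      (by
        rintro m s ⟨z, k, rfl, hs⟩ hc
        simp only [Test.Holds, hs.reg4, hs.reg1] at hc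
        refine ⟨50, (reduceSlot_reaches hW hc hs).mono le_rfl ?_⟩
        rintro s' ⟨z', k', h1, h2⟩
        exact ⟨_, ⟨z', k', rfl, h1⟩, by omega⟩) _ s ⟨0, 0, rfl, h⟩
    have := liveCard_le n (s.mem 6)
    refine hr.mono (by omega) ?_
    rintro s' ⟨⟨z, k, -, hs⟩, hc⟩
    simp only [Test.Holds, hs.reg4, hs.reg1] at hc
    have hz := hs.z_le
    obtain rfl : z = 3 * n := by omega
    exact ⟨k, by have := hs.k_le; omega, hs.undoInv⟩
  refine (hl.seq (T' := 11 * (3 * n) + 2) fun s h => ?_).mono (by omega) fun _ h => h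
  obtain ⟨k, hk, h⟩ := h
  refine (Reaches.seq (T := 11 * (3 * n) + 1) (T' := 1) ?_
    fun s h => ⟨1, s, .skip s, le_rfl, h⟩).mono (by omega) fun _ h => h
  obtain ⟨k', hk', hr⟩ := Reaches.loop (W := W) (c := .lt 2 5) (p := undoStep)
    (fun m s => ∃ k, m = 11 * k ∧ UndoInv n nb op rho Final k s)
    (by
      rintro m s ⟨k, rfl, hs⟩ hc
      simp only [Test.Holds, hs.reg2, hs.reg5] at hc
      obtain ⟨k, rfl⟩ : ∃ j, k = j + 1 := ⟨k - 1, by omega⟩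
      exact ⟨10, (undoStep_reaches hs).mono le_rfl fun s' h1 => ⟨_, ⟨k, rfl, h1⟩, by omega⟩⟩)
    _ s ⟨k, rfl, h⟩
  refine hr.mono (by omega) ?_
  rintro s' ⟨⟨k, -, hs⟩, hc⟩
  simp only [Test.Holds, hs.reg2, hs.reg5] at hc
  obtain rfl : k = 0 := by omega
  exact hs

end RAM

/-! ### From a matching of the double cover to a permutation without 3-cycles -/

theorem rot_rot_rot (s : ℕ) : rot (rot (rot s)) = s := by
  simp only [rot]; split_ifs <;> omega

theorem rot_ne (s : ℕ) : rot s ≠ s := by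
  simp only [rot]; split_ifs <;> omega

theorem rot_orbit {s t : ℕ} (h : s / 3 = t / 3) : t = s ∨ t = rot s ∨ t = rot (rot s) := by
  simp only [rot]; split_ifs <;> omega

section

variable {n : ℕ} {nb op rho dead mk M sg : ℕ → ℕ}

theorem Packing.contracted_of_live (P : Packing n nb op rho dead mk) {s : ℕ} (hs : Live n dead s)
    (hm : mk (s / 3) ≠ 0) : Contracted n nb rho dead mk s (rho s) (rho (rho s)) := by
  obtain ⟨t, t₁, t₂, ht, T⟩ := P.tri (s / 3) (by have := hs.1; omega) hm
  obtain rfl := T.eq_of s hs.1 ht.symm hs.2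
  rwa [T.rho_eq, T.rho_eq₁]

/-- In the double cover, the edge of the left slot `s` ends in the right slot `op s`. Agreement with
`op` is required below `3 * n` only, because that is all the arrays in memory satisfy. -/
theorem Packing.bipartite (H : Arcs n nb op) (P : Packing n nb op rho dead mk) {p q : ℕ → ℕ}
    (hp : ∀ s < 3 * n, p s = op s) (hq : ∀ s < 3 * n, q s = op s) :
    Bipartite rho p q (Live n dead) (Live n dead) := by
  have h1 : ∀ s, Live n dead s → Live n dead (rho s) ∧ rho (rho (rho s)) = s ∧ rho s ≠ s := by
    intro s hs
    by_cases hm : mk (s / 3) = 0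
    · have e1 := (P.free s hs.1 hm).2
      have l1 := rot_lt hs.1
      have m1 : mk (rot s / 3) = 0 := by rwa [rot_div]
      have e2 := P.free (rot s) l1 m1
      have e3 := P.free (rot (rot s)) (rot_lt l1) (by rwa [rot_div])
      rw [e1, e2.2, e3.2]
      exact ⟨⟨l1, e2.1⟩, rot_rot_rot s, rot_ne s⟩
    · have T := P.contracted_of_live hs hm
      exact ⟨⟨T.lt₁, T.live₁⟩, T.rho_eq₂, fun h => T.ne (by rw [h])⟩
  have h2 : ∀ s, Live n dead s → Live n dead (op s) := fun s hs =>
    ⟨H.op_lt s hs.1, P.op_live s hs.1 hs.2⟩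
  refine ⟨fun s hs => (h1 s hs).1, fun s hs => (h1 s hs).1, fun s hs => (h1 s hs).2.1,
    fun s hs => (h1 s hs).2.1, fun s hs => (h1 s hs).2.2, fun s hs => (h1 s hs).2.2,
    fun s hs => ?_, fun s hs => ?_, fun s hs => ?_, fun s hs => ?_⟩
  · rw [hp s hs.1]; exact h2 s hs
  · rw [hq s hs.1]; exact h2 s hs
  · rw [hp s hs.1, hq _ (H.op_lt s hs.1), H.op_op s hs.1]
  · rw [hq s hs.1, hp _ (H.op_lt s hs.1), H.op_op s hs.1]

/-- At an unmarked vertex all slots are live and `rho` is `rot`; at a marked vertex only one slot is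
live. -/
theorem Packing.orbit (P : Packing n nb op rho dead mk) {s t : ℕ} (hs : Live n dead s)
    (ht : Live n dead t) (h : s / 3 = t / 3) : t = s ∨ t = rho s ∨ t = rho (rho s) := by
  by_cases hm : mk (s / 3) = 0
  · have e1 := (P.free s hs.1 hm).2
    have e2 := (P.free (rot s) (rot_lt hs.1) (by rwa [rot_div])).2
    rw [e1, e2]
    exact rot_orbit h
  · exact Or.inl ((P.contracted_of_live hs hm).eq_of t ht.1 h.symm ht.2)

theorem Packing.exists_live (P : Packing n nb op rho dead mk) {v : ℕ} (hv : v < n) :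
    ∃ s, Live n dead s ∧ s / 3 = v := by
  by_cases hm : mk v = 0
  · have h : 3 * v / 3 = v := by omega
    exact ⟨3 * v, ⟨by omega, (P.free (3 * v) (by omega) (by rwa [h])).1⟩, h⟩
  · obtain ⟨t, t₁, t₂, ht, T⟩ := P.tri v hv hm
    exact ⟨t, ⟨T.lt, T.live⟩, ht⟩

/-- The values of the permutation `sg` that the element `m` of the matching determines. At a
contracted triangle the matching is extended through the triangle. -/
def StepSpec (nb op rho M sg : ℕ → ℕ) (m : ℕ) : Prop :=
  sg (m / 3) = nb m ∧ (rho m / 3 ≠ m / 3 →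
    (M (op m) ≠ 0 ∧ sg (rho m / 3) = rho (rho m) / 3 ∧ sg (rho (rho m) / 3) = rho m / 3) ∨
    (M (op m) = 0 ∧ M (op (rho m)) ≠ 0 ∧ sg (rho m / 3) = rho (rho m) / 3 ∧
      sg (rho (rho m) / 3) = m / 3) ∨
    (M (op m) = 0 ∧ M (op (rho m)) = 0 ∧ sg (rho (rho m) / 3) = rho m / 3 ∧
      sg (rho m / 3) = m / 3))

/-- The perfect matchings of the double cover of the contracted graph. -/
abbrev CoverMatching (n : ℕ) (op rho dead M : ℕ → ℕ) : Prop :=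
  PerfectAvoiding rho op (Live n dead) (Live n dead) (3 * n) M

/-- Each orbit of `rho` contains just one matched slot, and live slots at one vertex share an orbit.
So distinct elements of the matching determine values of the permutation at disjoint sets of
vertices. -/
theorem CoverMatching.eq_of_div_eq (H : Arcs n nb op) (P : Packing n nb op rho dead mk)
    (hM : CoverMatching n op rho dead M) {m m' x y : ℕ} (hm : M m ≠ 0) (hm' : M m' ≠ 0)
    (hx : x = m ∨ x = rho m ∨ x = rho (rho m)) (hy : y = m' ∨ y = rho m' ∨ y = rho (rho m'))
    (h : x / 3 = y / 3) : m' = m := by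
  have B := P.bipartite H (fun _ _ => rfl) (fun _ _ => rfl)
  have l := hM.supp m hm
  have l' := hM.supp m' hm'
  have l1 := B.rhoL m l
  have l2 := B.rhoL _ l1
  have l1' := B.rhoL m' l'
  have l2' := B.rhoL _ l1'
  have c := B.cubeL m l
  have c' := B.cubeL m' l'
  have lx : Live n dead x := by rcases hx with rfl | rfl | rfl <;> assumption
  have ly : Live n dead y := by rcases hy with rfl | rfl | rfl <;> assumption
  have ho := P.orbit lx ly h
  have hs := hM.left m l
  have : m' = m ∨ m' = rho m ∨ m' = rho (rho m) := by grind
  rcases this with h | h | h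
  · exact h
  · rw [h] at hm'; omega
  · rw [h] at hm'; omega

theorem CoverMatching.exists_mem (H : Arcs n nb op) (P : Packing n nb op rho dead mk)
    (hM : CoverMatching n op rho dead M) {s : ℕ} (hs : Live n dead s) :
    ∃ m, M m ≠ 0 ∧ (s = m ∨ s = rho m ∨ s = rho (rho m)) := by
  have B := P.bipartite H (fun _ _ => rfl) (fun _ _ => rfl)
  have h := hM.left s hs
  have c := B.cubeL s hs
  by_cases h1 : M s = 0
  · by_cases h2 : M (rho s) = 0
    · exact ⟨rho (rho s), by omega, by simp [c]⟩
    · exact ⟨rho s, h2, by simp [c]⟩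
  · exact ⟨s, h1, by simp⟩

/-- The contracted graph has no loops: an outer slot that led back into its triangle would coincide
with an inner arc, and inner arcs are dead. -/
theorem Packing.nb_ne (H : Arcs n nb op) (P : Packing n nb op rho dead mk) {s s₁ s₂ : ℕ}
    (T : Contracted n nb rho dead mk s s₁ s₂) : nb s ≠ s₁ / 3 ∧ nb s ≠ s₂ / 3 := by
  constructor
  · intro h
    obtain ⟨c, hc, h1, h2, h3⟩ := T.arc
    obtain rfl := H.inj c hc s T.lt h1 (h2.trans h.symm)
    exact h3 T.live
  · intro h
    obtain ⟨c, hc, h1, h2, h3⟩ := T.arc₂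
    obtain h4 := H.inj _ (H.op_lt c hc) s T.lt ((H.op_div c hc).trans h2)
      ((H.nb_op c hc).trans (h1.trans h.symm))
    have := P.op_live s T.lt T.live
    rw [← h4, H.op_op c hc] at this
    exact h3 this

/-- A permutation of the vertices that moves every vertex along an arc and has no cycles of
length 3. -/
structure ArcPerm (n : ℕ) (nb sg : ℕ → ℕ) : Prop where
  arc : ∀ v < n, HasArc n nb v (sg v)
  inj : ∀ v < n, ∀ w < n, sg v = sg w → v = w
  no_three : ∀ v < n, sg (sg (sg v)) ≠ v

theorem HasArc.lt_right {u w : ℕ} (H : Arcs n nb op) (h : HasArc n nb u w) : w < n := by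
  obtain ⟨c, hc, rfl, rfl⟩ := h
  exact H.nb_lt c hc

theorem injective_of_surjective_below {n : ℕ} {f : ℕ → ℕ} (hf : ∀ v < n, f v < n)
    (hs : ∀ w < n, ∃ v < n, f v = w) : ∀ v < n, ∀ w < n, f v = f w → v = w := by
  let g : Fin n → Fin n := fun v => ⟨f v, hf v v.2⟩
  have hg : Function.Surjective g := fun w => by
    obtain ⟨v, hv, h⟩ := hs w w.2
    exact ⟨⟨v, hv⟩, Fin.ext h⟩
  intro v hv w hw h
  have := Finite.injective_iff_surjective.2 hg (a₁ := ⟨v, hv⟩) (a₂ := ⟨w, hw⟩) (Fin.ext h)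
  exact congrArg Fin.val this

/-- Injectivity comes from surjectivity, which is the visible property: a vertex is entered through
a matched right slot or from within its triangle. -/
theorem CoverMatching.arcPerm (H : Arcs n nb op) (P : Packing n nb op rho dead mk)
    (hmax : MaximalBelow n nb mk (3 * n)) (hM : CoverMatching n op rho dead M)
    (hsg : ∀ m, M m ≠ 0 → StepSpec nb op rho M sg m) : ArcPerm n nb sg := by
  have B := P.bipartite H (fun _ _ => rfl) (fun _ _ => rfl)
  -- every vertex is free or in the triangle of some element of the matching
  have cases : ∀ v < n, ∃ m, M m ≠ 0 ∧ Live n dead m ∧ ((mk v = 0 ∧ m / 3 = v) ∨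
      (Contracted n nb rho dead mk m (rho m) (rho (rho m)) ∧
        (v = m / 3 ∨ v = rho m / 3 ∨ v = rho (rho m) / 3))) := by
    intro v hv
    obtain ⟨s, hs, rfl⟩ := P.exists_live hv
    obtain ⟨m, hm, h⟩ := hM.exists_mem H P hs
    have lm := hM.supp m hm
    refine ⟨m, hm, lm, ?_⟩
    by_cases hmk : mk (s / 3) = 0
    · refine Or.inl ⟨hmk, ?_⟩
      by_contra hne
      have hmk' : mk (m / 3) = 0 := by
        by_contra hmk'
        have T := P.contracted_of_live lm hmk'
        rcases h with rfl | rfl | rfl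
        · exact T.mk_ne hmk
        · exact T.mk_ne₁ hmk
        · exact T.mk_ne₂ hmk
      have e1 := (P.free m lm.1 hmk').2
      have e2 := (P.free (rot m) (rot_lt lm.1) (by rwa [rot_div])).2
      rw [e1, e2] at h
      rcases h with rfl | rfl | rfl
      · exact hne rfl
      · exact hne (rot_div m).symm
      · exact hne (((rot_div _).trans (rot_div m)).symm)
    · right
      have T := P.contracted_of_live hs hmk
      have cm := B.cubeL m lm
      rcases h with rfl | rfl | rfl
      · exact ⟨T, Or.inl rfl⟩
      · rw [cm] at T
        exact ⟨T.rotate.rotate, Or.inr (Or.inl rfl)⟩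
      · rw [cm] at T
        exact ⟨T.rotate, Or.inr (Or.inr rfl)⟩
  have arc : ∀ v < n, HasArc n nb v (sg v) := by
    intro v hv
    obtain ⟨m, hm, lm, ⟨-, rfl⟩ | ⟨T, hv'⟩⟩ := cases v hv
    · exact ⟨m, lm.1, rfl, (hsg m hm).1.symm⟩
    · have h1 := T.arc.hasArc
      have h2 := T.arc₁.hasArc
      have h3 := T.arc₂.hasArc
      have h1' := h1.symm H
      have h2' := h2.symm H
      have h3' := h3.symm H
      obtain ⟨s1, s2⟩ := hsg m hm
      rcases hv' with rfl | rfl | rfl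
      · exact ⟨m, lm.1, rfl, s1.symm⟩
      · rcases s2 T.ne.symm with ⟨-, e1, e2⟩ | ⟨-, -, e1, e2⟩ | ⟨-, -, e1, e2⟩
        · rwa [e1]
        · rwa [e1]
        · rwa [e2]
      · rcases s2 T.ne.symm with ⟨-, e1, e2⟩ | ⟨-, -, e1, e2⟩ | ⟨-, -, e1, e2⟩
        · rwa [e2]
        · rwa [e2]
        · rwa [e1]
  have back : ∀ r, Live n dead r → M (op r) ≠ 0 → ∃ v < n, sg v = r / 3 := by
    intro r hr hr'
    have lr := hM.supp _ hr'
    have := lr.1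
    exact ⟨op r / 3, by omega, by rw [(hsg _ hr').1, H.nb_op r hr.1]⟩
  have surj : ∀ w < n, ∃ v < n, sg v = w := by
    intro w hw
    obtain ⟨m, hm, lm, ⟨hmk, rfl⟩ | ⟨T, hv'⟩⟩ := cases w hw
    · have e1 := (P.free m lm.1 hmk).2
      have e2 := (P.free (rot m) (rot_lt lm.1) (by rwa [rot_div])).2
      have hr := hM.right m lm
      have l1 := B.rhoL m lm
      have l2 := B.rhoL _ l1
      have d1 : rho m / 3 = m / 3 := by rw [e1, rot_div]
      have d2 : rho (rho m) / 3 = m / 3 := by rw [e1, e2, rot_div, rot_div]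
      by_cases h1 : M (op m) = 0
      · by_cases h2 : M (op (rho m)) = 0
        · rw [← d2]; exact back _ l2 (by omega)
        · rw [← d1]; exact back _ l1 h2
      · exact back m lm h1
    · have hr := hM.right m lm
      have l1 := B.rhoL m lm
      have l2 := B.rhoL _ l1
      have b0 : m / 3 < n := by have := lm.1; omega
      have b1 : rho m / 3 < n := by have := l1.1; omega
      have b2 : rho (rho m) / 3 < n := by have := l2.1; omega
      rcases (hsg m hm).2 T.ne.symm with ⟨h0, e1, e2⟩ | ⟨-, h0, e1, e2⟩ | ⟨h0, h1, e1, e2⟩ <;>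
        rcases hv' with rfl | rfl | rfl
      · exact back _ lm h0
      · exact ⟨_, b2, e2⟩
      · exact ⟨_, b1, e1⟩
      · exact ⟨_, b2, e2⟩
      · exact back _ l1 h0
      · exact ⟨_, b1, e1⟩
      · exact ⟨_, b1, e2⟩
      · exact ⟨_, b2, e1⟩
      · exact back _ l2 (by omega)
  have lt : ∀ v < n, sg v < n := fun v hv => (arc v hv).lt_right H
  have inj := injective_of_surjective_below lt surj
  -- If the triangle is entered and left at the same vertex, its vertices lie on 2-cycles. Otherwise
  -- the cycle runs through all three of them and then through `nb m`, which lies outside, so its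
  -- length is at least 4.
  have marked : ∀ v < n, mk v ≠ 0 → sg (sg (sg v)) ≠ v := by
    intro v hv hmk h3
    obtain ⟨m, hm, lm, ⟨hmk', -⟩ | ⟨T, hv'⟩⟩ := cases v hv
    · exact hmk hmk'
    obtain ⟨n1, n2⟩ := P.nb_ne H T
    have n0 := H.ne m lm.1
    have t1 := T.ne
    have t2 := T.ne₁
    have t3 := T.ne₂
    have l1 := B.rhoL m lm
    have l2 := B.rhoL _ l1
    have b0 : m / 3 < n := by have := lm.1; omega
    have b1 : rho m / 3 < n := by have := l1.1; omega
    have b2 : rho (rho m) / 3 < n := by have := l2.1; omega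
    have s1 := (hsg m hm).1
    have lnb := H.nb_lt m lm.1
    have i1 := inj (nb m) lnb _ b0
    have i2 := inj (nb m) lnb _ b1
    have i3 := inj (nb m) lnb _ b2
    rcases (hsg m hm).2 T.ne.symm with ⟨h0, e1, e2⟩ | ⟨-, h0, e1, e2⟩ | ⟨h0, h1, e1, e2⟩
    · have s2 := (hsg _ h0).1
      rw [H.op_div m lm.1, H.nb_op m lm.1] at s2
      rcases hv' with rfl | rfl | rfl <;> grind
    · rcases hv' with rfl | rfl | rfl <;> grind
    · rcases hv' with rfl | rfl | rfl <;> grind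
  refine ⟨arc, inj, fun v hv h3 => ?_⟩
  have a1 := arc v hv
  have l1 := lt v hv
  have a2 := arc _ l1
  have l2 := lt _ l1
  have a3 := arc _ l2
  rw [h3] at a3
  obtain ⟨c, hc, hc1, hc2⟩ := a1
  obtain ⟨d, hd, hd1, hd2⟩ := a3.symm H
  have hcd : c ≠ d := by
    rintro rfl
    have : sg (sg v) = sg v := hd2.symm.trans hc2
    have := inj _ l1 _ hv this
    exact H.ne c hc (by omega)
  -- Two distinct slots of `v` are cyclically consecutive in one of the two orders, so the triangle
  -- of a 3-cycle is among those covered by maximality. One of its vertices is then marked, and all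
  -- three lie on the 3-cycle.
  rcases rot_orbit (hc1.trans hd1.symm) with h | h | h
  · exact hcd h.symm
  · have := hmax c hc
    rw [← h, hc1, hc2, hd2] at this
    have h' := this a2
    by_cases m1 : mk v = 0
    · by_cases m2 : mk (sg v) = 0
      · exact marked _ l2 (by omega) (by rw [h3])
      · exact marked _ l1 m2 (by rw [h3])
    · exact marked _ hv m1 h3
  · have h'' : rot d = c := by rw [h, rot_rot_rot]
    have := hmax d hd
    rw [h'', hd1, hc2, hd2] at this
    have h' := this (a2.symm H)
    by_cases m1 : mk v = 0
    · by_cases m2 : mk (sg v) = 0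
      · exact marked _ l2 (by omega) (by rw [h3])
      · exact marked _ l1 m2 (by rw [h3])
    · exact marked _ hv m1 h3

end

theorem StepSpec.congr {nb op rho M sg sg' : ℕ → ℕ} {m : ℕ} (h : StepSpec nb op rho M sg m)
    (h0 : sg' (m / 3) = sg (m / 3)) (h1 : sg' (rho m / 3) = sg (rho m / 3))
    (h2 : sg' (rho (rho m) / 3) = sg (rho (rho m) / 3)) : StepSpec nb op rho M sg' m := by
  rw [StepSpec, h0, h1, h2]
  exact h

/-! ### Computing the permutation -/

namespace RAM

variable {n W : ℕ} {nb op rho dead mk M : ℕ → ℕ}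

/-- Follows the element of the matching in register 4 through its triangle. -/
def expandSlot : Prog :=
  block [.load 6 5 4, .load 7 5 6, .load 8 2 4, .load 9 2 6, .load 10 2 7, .load 11 0 8,
    .load 12 0 9, .load 13 0 10, .load 14 10 8, .load 15 10 9,
    .branch (.eq 14 2)
      (.branch (.eq 15 2) (block [.store 11 13 12, .store 11 12 11])
        (block [.store 11 12 13, .store 11 13 11]))
      (block [.store 11 12 13, .store 11 13 12]),
    .load 16 0 4, .store 11 11 16]

def permSlot : Prog :=
  block [.load 5 10 4, .branch (.eq 5 2) .skip expandSlot, .add 4 4 3]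

/-- Turns the perfect matching into a permutation of the vertices. -/
def permutation : Prog :=
  block [.const 4 0, .loop (.lt 4 1) permSlot]

structure PermInv (n : ℕ) (nb op rho M : ℕ → ℕ) (i : ℕ) (s : State) :
    Prop extends Frame n nb s where
  reg4 : s.reg 4 = i
  mem2 : s.mem 2 = op
  mem5 : s.mem 5 = rho
  mem10 : s.mem 10 = M
  spec : ∀ m < i, M m ≠ 0 → StepSpec nb op rho M (s.mem 11) m
  mem_zero : ∀ b, b = 1 ∨ 11 < b → s.mem b = 0

theorem permSlot_reaches (hW : 20 * (n + 1) ≤ W) (H : Arcs n nb op)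
    (P : Packing n nb op rho dead mk) (hM : CoverMatching n op rho dead M) {i : ℕ} {s : State}
    (hi : i < 3 * n) (h : PermInv n nb op rho M i s) :
    Reaches W permSlot s 40 (PermInv n nb op rho M (i + 1)) := by
  obtain ⟨⟨h0, h1, h2, h3, m0⟩, h4, m2, m5, m10, hsp, mz⟩ := h
  refine (Reaches.of_wp (Q := PermInv n nb op rho M (i + 1)) ?_).mono (by decide) fun _ h => h
  simp only [permSlot, wp_block_cons, wp_block_nil, wp, Test.Holds]
  simp only [State.setReg_reg, h4, h2, m10, Nat.reduceEqDiff, if_true, if_false]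
  refine ⟨fun hc => ?_, fun hc => ?_⟩
  · simp [h3]
    refine ⟨by omega, ⟨?_, ?_, ?_, ?_, ?_⟩, ?_, ?_, ?_, ?_, fun m hm hm' => ?_, fun b hb => ?_⟩
    any_goals simp [h0, h1, h2, h3, m0, m2, m5, m10]
    · obtain hm | rfl : m < i ∨ m = i := by omega
      · exact hsp m hm hm'
      · exact absurd hc hm'
    · exact mz b (by omega)
  · have B := P.bipartite H (fun _ _ => rfl) (fun _ _ => rfl)
    have l0 := hM.supp i hc
    have l1 := B.rhoL i l0
    have l2 := B.rhoL _ l1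
    have o0 := H.nb_op i l0.1
    have o1 := H.nb_op _ l1.1
    have o2 := H.nb_op _ l2.1
    -- The cells written for `i` belong to vertices that no earlier element of the matching uses, so
    -- earlier specifications survive.
    have old : ∀ sg, (∀ x, x ≠ i / 3 → x ≠ rho i / 3 → x ≠ rho (rho i) / 3 → sg x = s.mem 11 x) →
        StepSpec nb op rho M sg i → ∀ m < i + 1, M m ≠ 0 → StepSpec nb op rho M sg m := by
      intro sg hsg hspi m hm hm'
      obtain hm | rfl : m < i ∨ m = i := by omega
      · have key := fun x y hx hy h => hm.ne
          (CoverMatching.eq_of_div_eq (x := x) (y := y) H P hM hc hm' hx hy h)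
        refine (hsp m hm hm').congr (hsg _ ?_ ?_ ?_) (hsg _ ?_ ?_ ?_) (hsg _ ?_ ?_ ?_) <;>
          exact fun h => key _ _ (by simp) (by simp) h.symm
      · exact hspi
    -- At an unmarked vertex all three slots have the same tail, and the last store overwrites
    -- whatever the branches wrote there. Only contracted triangles need distinct cells.
    have tri : rho i / 3 ≠ i / 3 → rho i / 3 ≠ rho (rho i) / 3 ∧ rho (rho i) / 3 ≠ i / 3 := by
      intro hne
      have T := P.contracted_of_live l0 fun hm =>
        hne (by rw [(P.free i l0.1 hm).2, rot_div])
      exact ⟨T.ne₁, T.ne₂⟩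
    simp [expandSlot, wp, Test.Holds, h2, h3, h4, m0, m2, m5, m10, o0, o1, o2]
    have hi' : i + 1 ≤ W := by omega
    refine ⟨fun ha => ⟨fun hb => ⟨hi', ⟨?_, ?_, ?_, ?_, ?_⟩, ?_, ?_, ?_, ?_, old _ ?_ ?_,
      fun b hb => ?_⟩, fun hb => ⟨hi', ⟨?_, ?_, ?_, ?_, ?_⟩, ?_, ?_, ?_, ?_, old _ ?_ ?_,
      fun b hb => ?_⟩⟩, fun ha => ⟨hi', ⟨?_, ?_, ?_, ?_, ?_⟩, ?_, ?_, ?_, ?_, old _ ?_ ?_,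
      fun b hb => ?_⟩⟩
    any_goals simp [h0, h1, h2, h3, m0, m2, m5, m10]
    any_goals exact fun x e0 e1 e2 => by simp [e0, e1, e2]
    any_goals
      have : b ≠ 11 := by omega
      simp [this, mz b (by omega)]
    all_goals
      refine ⟨by simp, fun hne => ?_⟩
      obtain ⟨hne1, hne2⟩ := tri hne
      simp [hne1.symm, *]

theorem permutation_reaches (hW : 20 * (n + 1) ≤ W) (H : Arcs n nb op)
    (P : Packing n nb op rho dead mk) (hM : CoverMatching n op rho dead M) {s : State}
    (h : PermInv n nb op rho M 0 (s.setReg 4 0)) :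
    Reaches W permutation s (200 * (n + 1)) (PermInv n nb op rho M (3 * n)) := by
  have h' : Reaches W (.const 4 0) s 1 (PermInv n nb op rho M 0) := Reaches.of_wp ⟨by omega, h⟩
  refine (h'.seq (T' := 41 * (3 * n) + 2) fun s h => ?_).mono (by omega) fun _ h => h
  exact (Reaches.loop_lt (T := 40) (N := 3 * n) (fun i => PermInv n nb op rho M i)
    (fun m s hs => ⟨hs.reg4, hs.reg1⟩)
    (fun m s hm hs => permSlot_reaches hW H P hM hm hs) h).seq
    (T' := 1) fun s h => ⟨1, s, .skip s, le_rfl, h⟩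

/-- The state in which a permutation of the vertices has been found. -/
structure PermDone (n : ℕ) (nb op : ℕ → ℕ) (s : State) : Prop extends Frame n nb s where
  arcs : Arcs n nb op
  mem2 : s.mem 2 = op
  perm : ArcPerm n nb (s.mem 11)
  mem_zero : ∀ b, b = 1 ∨ 11 < b → s.mem b = 0

/-- The reduction starts with both sides equal to the live slots. In `Final` the slot to avoid is `3
* n`, which is no slot, so all that remains of the avoidance is perfection. -/
theorem PackInv.reduceInv (H : Arcs n nb op) {s : State} (h : PackInv n nb op (3 * n) s) :
    ReduceInv n nb op (s.mem 5) (CoverMatching n op (s.mem 5) (s.mem 6)) 0 0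
      ((s.setReg 4 0).setReg 5 0) := by
  obtain ⟨⟨h0, h1, h2, h3, m0⟩, h4, m2, m3, m4, P, hmax, mz⟩ := h
  have B := P.bipartite H m3 m4
  refine ⟨⟨?_, ?_, ?_, ?_, ?_⟩, ?_, ?_, ?_, ?_, ?_, ?_, ?_, ⟨Live n (s.mem 6), B, ?_⟩, fun b hb => ?_⟩
  any_goals simp [h0, h1, h2, h3, m0, m2]
  · exact liveCard_le _ _
  · intro M hM
    refine ⟨hM.supp, hM.left, fun r hr => ?_, fun hr => absurd hr.1 (lt_irrefl _)⟩
    have l1 := B.rhoR r hr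
    have l2 := B.rhoR _ l1
    rw [← m4 r hr.1, ← m4 _ l1.1, ← m4 _ l2.1]
    exact hM.right r hr
  · exact mz b (by omega)

theorem UndoInv.permInv {Final : (ℕ → ℕ) → Prop} {s : State}
    (h : UndoInv n nb op rho Final 0 s) :
    PermInv n nb op rho (s.mem 10) 0 (s.setReg 4 0) := by
  obtain ⟨⟨h0, h1, h2, h3, m0⟩, h5, m2, m5, -, mz⟩ := h
  refine ⟨⟨?_, ?_, ?_, ?_, ?_⟩, ?_, ?_, ?_, ?_, ?_, fun b hb => ?_⟩
  any_goals simp [h0, h1, h2, h3, m0, m2, m5]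
  exact mz b (by omega)

/-- Finds the permutation of the vertices. -/
def findPermutation : Prog :=
  block [link, pack, perfectMatching, permutation]

theorem findPermutation_reaches (hW : 20 * (n + 1) ≤ W) (H : Arcs n nb op) {s : State}
    (hn : ∀ i, s.reg i = if i = 0 then n else 0) (m0 : s.mem 0 = nb)
    (mz : ∀ b, b ≠ 0 → s.mem b = 0) :
    Reaches W findPermutation s (1500 * (n + 1)) (fun s' => ∃ op, PermDone n nb op s') := by
  refine ((link_reaches hW H hn m0 mz).seq (T' := 1400 * n + 1400) fun s h => ?_).mono
    (by omega) fun _ h => h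
  have H := H.congr h.mem2
  refine ((pack_reaches hW ‹_› h).seq (T' := 900 * n + 900) fun s' h => ?_).mono
    (by omega) fun _ h => h
  have P := h.packing
  have hmax := h.maximal
  refine ((perfectMatching_reaches hW (h.reduceInv H)).seq (T' := 300 * n + 300)
    fun s'' h => ?_).mono (by omega) fun _ h => h
  have hM := h.final
  refine ((permutation_reaches hW H P hM h.permInv).seq (T' := 1)
    fun s h => ⟨1, s, .skip s, le_rfl, ?_⟩).mono (by omega) fun _ h => h
  exact ⟨_, h.toFrame, H, h.mem2, hM.arcPerm H P hmax fun m hm =>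
    h.spec m (hM.supp m hm).1 hm, h.mem_zero⟩

end RAM

/-! ### Colorings of the cycles of a permutation -/

open Function in
/-- `vis'` arises from `vis` when the first `i` points of the orbit of `v` get the colors `c`. -/
def Painted (f : ℕ → ℕ) (v i : ℕ) (c vis vis' : ℕ → ℕ) : Prop :=
  (∀ j < i, vis' (f^[j] v) = c j) ∧ ∀ x, (∀ j < i, x ≠ f^[j] v) → vis' x = vis x

/-- The alternating colors `a`, `K - a`, `a`, … -/
def altColor (a K j : ℕ) : ℕ := if Even j then a else K - a

theorem altColor_succ {a K : ℕ} (h : a ≤ K) (j : ℕ) : altColor a K (j + 1) = K - altColor a K j := by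
  simp only [altColor, Nat.even_add_one]
  split_ifs <;> omega

theorem ArcPerm.mapsTo {n : ℕ} {nb op f : ℕ → ℕ} (H : Arcs n nb op) (h : ArcPerm n nb f) {v : ℕ}
    (hv : v < n) : f v < n :=
  (h.arc v hv).lt_right H

theorem ArcPerm.iterate_lt {n : ℕ} {nb op f : ℕ → ℕ} (H : Arcs n nb op) (h : ArcPerm n nb f) {v : ℕ}
    (hv : v < n) (j : ℕ) : f^[j] v < n := by
  induction j with
  | zero => exact hv
  | succ j ih => rw [Function.iterate_succ_apply']; exact h.mapsTo H ih

theorem ArcPerm.mem_periodicPts {n : ℕ} {nb op f : ℕ → ℕ} (H : Arcs n nb op) (h : ArcPerm n nb f)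
    {v : ℕ} (hv : v < n) : v ∈ Function.periodicPts f := by
  let g : Fin n → Fin n := fun v => ⟨f v, h.mapsTo H v.2⟩
  have hg : Function.Injective g := fun a b hab =>
    Fin.ext (h.inj a a.2 b b.2 (congrArg Fin.val hab))
  obtain ⟨k, hk, hp⟩ := hg.mem_periodicPts ⟨v, hv⟩
  have key : Function.Semiconj (Fin.val : Fin n → ℕ) g f := fun x => rfl
  refine ⟨k, hk, ?_⟩
  have := (key.iterate_right k) ⟨v, hv⟩
  rw [hp] at this
  exact this.symm

theorem Painted.zero (f : ℕ → ℕ) (v : ℕ) (c vis : ℕ → ℕ) : Painted f v 0 c vis vis :=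
  ⟨fun j hj => absurd hj (Nat.not_lt_zero j), fun _ _ => rfl⟩

theorem iterate_ne {f : ℕ → ℕ} {v i j : ℕ} (hi : i < Function.minimalPeriod f v)
    (hj : j < Function.minimalPeriod f v) (h : i ≠ j) : f^[i] v ≠ f^[j] v :=
  fun h' => h (Function.iterate_injOn_Iio_minimalPeriod hi hj h')

theorem Painted.succ {f : ℕ → ℕ} {v i : ℕ} {c vis vis' : ℕ → ℕ} (h : Painted f v i c vis vis')
    (hi : i < Function.minimalPeriod f v) :
    Painted f v (i + 1) c vis (Function.update vis' (f^[i] v) (c i)) := by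
  refine ⟨fun j hj => ?_, fun x hx => ?_⟩
  · obtain hj | rfl : j < i ∨ j = i := by omega
    · rw [Function.update_of_ne (iterate_ne (by omega) hi hj.ne), h.1 j hj]
    · rw [Function.update_self]
  · rw [Function.update_of_ne (hx i (by omega)), h.2 x fun j hj => hx j (by omega)]

theorem Painted.trans {f : ℕ → ℕ} {v i : ℕ} {c c' vis vis' vis'' : ℕ → ℕ}
    (h : Painted f v i c vis vis') (h' : Painted f v i c' vis' vis'') :
    Painted f v i c' vis vis'' :=
  ⟨h'.1, fun x hx => (h'.2 x hx).trans (h.2 x hx)⟩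

/-- The number of vertices without color. -/
def unvisited (n : ℕ) (vis : ℕ → ℕ) : ℕ := ((Finset.range n).filter (vis · = 0)).card

/-- The amortization: walking around a cycle costs a multiple of its length, and all its vertices
leave the set of uncolored ones. -/
theorem Painted.unvisited_add_le {n : ℕ} {f : ℕ → ℕ} {v : ℕ} {c vis vis' : ℕ → ℕ}
    (h : Painted f v (Function.minimalPeriod f v) c vis vis') (hc : ∀ j, c j ≠ 0)
    (hlt : ∀ j, f^[j] v < n) (hz : ∀ j, vis (f^[j] v) = 0) :
    unvisited n vis' + Function.minimalPeriod f v ≤ unvisited n vis := by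
  let S := (Finset.range (Function.minimalPeriod f v)).image fun j => f^[j] v
  have hS : S.card = Function.minimalPeriod f v := by
    rw [Finset.card_image_of_injOn, Finset.card_range]
    intro i hi j hj hij
    simp only [Finset.coe_range] at hi hj
    exact Function.iterate_injOn_Iio_minimalPeriod hi hj hij
  have hd : Disjoint ((Finset.range n).filter (vis' · = 0)) S := by
    rw [Finset.disjoint_right]
    intro x hx hx'
    obtain ⟨j, hj, rfl⟩ := Finset.mem_image.1 hx
    have := (Finset.mem_filter.1 hx').2
    rw [h.1 j (Finset.mem_range.1 hj)] at this
    exact hc j this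
  rw [unvisited, ← hS, ← Finset.card_union_of_disjoint hd]
  apply Finset.card_le_card
  intro x hx
  rcases Finset.mem_union.1 hx with hx | hx
  · rw [Finset.mem_filter] at hx ⊢
    refine ⟨hx.1, ?_⟩
    by_cases hx' : ∀ j < Function.minimalPeriod f v, x ≠ f^[j] v
    · rw [← h.2 x hx']; exact hx.2
    · push Not at hx'
      obtain ⟨j, -, rfl⟩ := hx'
      exact hz j
  · obtain ⟨j, -, rfl⟩ := Finset.mem_image.1 hx
    exact Finset.mem_filter.2 ⟨Finset.mem_range.2 (hlt j), hz j⟩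

/-- The cycles of `f` through visited vertices are colored: odd cycles by the color 4, even cycles
alternatingly by the colors 1 and 3. -/
def Colored (n : ℕ) (f vis : ℕ → ℕ) : Prop :=
  ∀ u < n, (vis u = 0 ∧ vis (f u) = 0) ∨ (vis u = 1 ∧ vis (f u) = 3) ∨ (vis u = 3 ∧ vis (f u) = 1) ∨
    (vis u = 4 ∧ vis (f u) = 4 ∧ Odd (Function.minimalPeriod f u))

theorem Colored.iterate {n : ℕ} {nb op f vis : ℕ → ℕ} (H : Arcs n nb op) (hf : ArcPerm n nb f)
    (h : Colored n f vis) {v : ℕ} (hv : v < n) (h0 : vis v = 0) (j : ℕ) : vis (f^[j] v) = 0 := by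
  induction j with
  | zero => exact h0
  | succ j ih =>
    rw [Function.iterate_succ_apply']
    have := h _ (hf.iterate_lt H hv j)
    omega

/-- The alternation closes up at `v` exactly because the cycle is even; on odd cycles the color is
constant. -/
theorem Colored.painted {n : ℕ} {nb op f vis vis' c : ℕ → ℕ} (H : Arcs n nb op)
    (hf : ArcPerm n nb f) (h : Colored n f vis) {v : ℕ} (hv : v < n)
    (hp : Painted f v (Function.minimalPeriod f v) c vis vis')
    (hc : (Odd (Function.minimalPeriod f v) ∧ ∀ j, c j = 4) ∨
      (Even (Function.minimalPeriod f v) ∧ c = altColor 3 4)) : Colored n f vis' := by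
  have hper := hf.mem_periodicPts H hv
  have hpos := Function.minimalPeriod_pos_of_mem_periodicPts hper
  obtain ⟨L, hL⟩ : ∃ L, L = Function.minimalPeriod f v := ⟨_, rfl⟩
  have hend : f^[L] v = v := by rw [hL]; exact Function.iterate_minimalPeriod
  rw [← hL] at hp hc hpos
  intro u hu
  by_cases hu' : ∃ j < L, u = f^[j] v
  · obtain ⟨j, hj, rfl⟩ := hu'
    have hm : Function.minimalPeriod f (f^[j] v) = L := by
      rw [hL]; exact Function.minimalPeriod_apply_iterate hper j
    rw [hm, hp.1 j hj, ← Function.iterate_succ_apply' f]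
    have hnext : vis' (f^[j + 1] v) = if j + 1 < L then c (j + 1) else c 0 := by
      split_ifs with hj'
      · exact hp.1 _ hj'
      · obtain rfl : j + 1 = L := by omega
        rw [hend]
        exact hp.1 0 hpos
    rw [hnext]
    rcases hc with ⟨hodd, hc⟩ | ⟨heven, rfl⟩
    · right; right; right
      rw [hc, hc, hc]
      simp [hodd]
    · by_cases hj' : j + 1 < L
      · rw [if_pos hj', altColor_succ (by norm_num), altColor]
        split_ifs <;> simp
      · obtain rfl : j + 1 = L := by omega
        rw [Nat.even_add_one] at heven
        simp [altColor, heven]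
  · have h1 : ∀ j < L, u ≠ f^[j] v := fun j hj h' => hu' ⟨j, hj, h'⟩
    -- By injectivity, a vertex whose image lies on the cycle lies on it too; the predecessor of `v`
    -- itself is `f^[L - 1] v`.
    have h2 : ∀ j < L, f u ≠ f^[j] v := by
      intro j hj h'
      obtain ⟨i, hi, hji⟩ : ∃ i < L, f^[j] v = f (f^[i] v) := by
        rcases j with _ | j
        · refine ⟨L - 1, by omega, ?_⟩
          rw [← Function.iterate_succ_apply' f, Nat.succ_eq_add_one, Nat.sub_add_cancel hpos, hend]
          rfl
        · exact ⟨j, by omega, Function.iterate_succ_apply' f j v⟩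
      exact h1 i hi (hf.inj u hu _ (hf.iterate_lt H hv i) (h'.trans hji))
    rw [hp.2 u h1, hp.2 _ h2]
    exact h u hu

/-! ### Walking along the cycles -/

namespace RAM

variable {n W : ℕ} {nb op f : ℕ → ℕ}

/-- Follows the permutation from register 8 on, writing the contents of register 9 and its difference
from register 10 alternatingly, until a vertex has a color that is not below register 6. -/
def walk : Prog :=
  .loop (.lt 7 6) (block [.store 12 8 9, .sub 9 10 9, .load 8 11 8, .load 7 12 8])

structure WalkInv (n : ℕ) (nb op f : ℕ → ℕ) (v : ℕ) (s : State) : Prop extends Frame n nb s where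
  reg4 : s.reg 4 = v
  mem1 : s.mem 1 = 0
  mem2 : s.mem 2 = op
  mem11 : s.mem 11 = f

/-- The walk stops exactly on its return to `v`: vertices not yet painted have colors below `T`,
while every painted vertex has a color of at least `T`. -/
theorem walk_reaches {v a K T : ℕ} {s : State} (h : WalkInv n nb op f v s)
    (hv : v ∈ Function.periodicPts f) (h6 : s.reg 6 = T) (h7 : s.reg 7 = s.mem 12 v)
    (h8 : s.reg 8 = v) (h9 : s.reg 9 = a) (h10 : s.reg 10 = K) (haK : a ≤ K) (hTa : T ≤ a)
    (hTK : T ≤ K - a) (hvis : ∀ j, s.mem 12 (f^[j] v) < T) :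
    Reaches W walk s (6 * Function.minimalPeriod f v + 1) (fun s' => WalkInv n nb op f v s' ∧
      s'.reg 7 = s'.mem 12 v ∧ s'.reg 8 = v ∧
      s'.reg 9 = altColor a K (Function.minimalPeriod f v) ∧
      Painted f v (Function.minimalPeriod f v) (altColor a K) (s.mem 12) (s'.mem 12)) := by
  obtain ⟨L, hL⟩ : ∃ L, L = Function.minimalPeriod f v := ⟨_, rfl⟩
  have hend : f^[L] v = v := by rw [hL]; exact Function.iterate_minimalPeriod
  rw [← hL]
  have hT : ∀ j, T ≤ altColor a K j := by
    intro j
    rw [altColor]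
    split_ifs <;> assumption
  obtain ⟨k', hk', hr⟩ := Reaches.loop (W := W) (c := .lt 7 6)
    (p := block [.store 12 8 9, .sub 9 10 9, .load 8 11 8, .load 7 12 8])
    (fun m s' => ∃ i ≤ L, m = 6 * (L - i) ∧ WalkInv n nb op f v s' ∧ s'.reg 6 = T ∧
      s'.reg 7 = s'.mem 12 (f^[i] v) ∧ s'.reg 8 = f^[i] v ∧ s'.reg 9 = altColor a K i ∧
      s'.reg 10 = K ∧ Painted f v i (altColor a K) (s.mem 12) (s'.mem 12))
    (by
      rintro m s' ⟨i, hi, rfl, ⟨⟨k0, k1, k2, k3, m0⟩, k4, m1, m2, m11⟩, k6, k7, k8, k9, k10, hp⟩ hc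
      have hiL : i < L := by
        rcases hi.lt_or_eq with hi | rfl
        · exact hi
        · rw [Test.Holds, k6, k7, hend] at hc
          have h1 := hp.1 0 (hL ▸ Function.minimalPeriod_pos_of_mem_periodicPts hv)
          have h2 := hT 0
          simp only [Function.iterate_zero, id] at h1
          omega
      refine ⟨5, (Reaches.of_wp (Q := fun s' => ∃ k', _) ?_).mono (by decide) fun _ h => h⟩
      have hp' := hp.succ (hL ▸ hiL)
      simp only [wp_block_cons, wp_block_nil, wp, State.setReg_reg, State.setReg_mem,
        State.setMem_reg, State.setMem_mem, k8, k9, k10, m11, Nat.reduceEqDiff, if_true, if_false]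
      refine ⟨_, ⟨i + 1, hiL, rfl, ⟨⟨?_, ?_, ?_, ?_, ?_⟩, ?_, ?_, ?_, ?_⟩, ?_, ?_, ?_, ?_, ?_, ?_⟩, ?_⟩
      any_goals simp [k0, k1, k2, k3, k4, k6, m0, m1, m2, m11, Function.iterate_succ_apply',
        altColor_succ haK]
      · exact hp'
      · omega) (6 * (L - 0)) s ⟨0, Nat.zero_le _, rfl, h, h6, h7, h8, by rw [h9]; rfl, h10,
        Painted.zero _ _ _ _⟩
  refine hr.mono (by omega) ?_
  rintro s' ⟨⟨i, hi, -, hw, k6, k7, k8, k9, k10, hp⟩, hc⟩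
  obtain rfl : i = L := by
    by_contra hne
    have h1 := hp.2 (f^[i] v) fun j hj => iterate_ne (by omega) (by omega) (by omega)
    have h2 := hvis i
    apply hc
    rw [Test.Holds, k6, k7, h1]
    exact h2
  rw [hend] at k7 k8
  exact ⟨hw, k7, k8, k9, hp⟩

/-- Colors the cycle through the vertex in register 4. -/
def colorCycle : Prog :=
  block [block [.move 8 4, .const 6 1, .const 9 3, .const 10 4], walk,
    .branch (.eq 9 3) (block [block [.const 6 4, .const 9 4, .const 10 8], walk]) .skip]

def colorVertex : Prog :=
  block [.load 7 12 4, .branch (.lt 7 3) colorCycle .skip, .add 4 4 3]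

/-- Colors all cycles of the permutation. -/
def color : Prog :=
  block [.const 4 0, .loop (.lt 4 0) colorVertex]

theorem WalkInv.setReg {v : ℕ} {s : State} (h : WalkInv n nb op f v s) {i w : ℕ} (hi : 4 < i) :
    WalkInv n nb op f v (s.setReg i w) := by
  obtain ⟨⟨h0, h1, h2, h3, m0⟩, h4, m1, m2, m11⟩ := h
  refine ⟨⟨?_, ?_, ?_, ?_, m0⟩, ?_, m1, m2, m11⟩ <;> simp [*] <;> omega

theorem colorCycle_reaches (hW : 20 * (n + 1) ≤ W) (H : Arcs n nb op) (hf : ArcPerm n nb f) {v : ℕ}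
    {s : State} (hv : v < n) (h : WalkInv n nb op f v s) (h7 : s.reg 7 = s.mem 12 v)
    (h0 : s.mem 12 v = 0) (hcol : Colored n f (s.mem 12)) :
    Reaches W colorCycle s (12 * Function.minimalPeriod f v + 20) (fun s' =>
      WalkInv n nb op f v s' ∧ Colored n f (s'.mem 12) ∧
      (∀ x, s.mem 12 x ≠ 0 → s'.mem 12 x ≠ 0) ∧ s'.mem 12 v ≠ 0 ∧
      unvisited n (s'.mem 12) + Function.minimalPeriod f v ≤ unvisited n (s.mem 12)) := by
  have hper := hf.mem_periodicPts H hv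
  have hz := hcol.iterate H hf hv h0
  have hlt := hf.iterate_lt H hv
  have hpos := Function.minimalPeriod_pos_of_mem_periodicPts hper
  have fin : ∀ (c : ℕ → ℕ) (s' : State), WalkInv n nb op f v s' →
      Painted f v (Function.minimalPeriod f v) c (s.mem 12) (s'.mem 12) → (∀ j, c j ≠ 0) →
      ((Odd (Function.minimalPeriod f v) ∧ ∀ j, c j = 4) ∨
        (Even (Function.minimalPeriod f v) ∧ c = altColor 3 4)) →
      WalkInv n nb op f v s' ∧ Colored n f (s'.mem 12) ∧
      (∀ x, s.mem 12 x ≠ 0 → s'.mem 12 x ≠ 0) ∧ s'.mem 12 v ≠ 0 ∧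
      unvisited n (s'.mem 12) + Function.minimalPeriod f v ≤ unvisited n (s.mem 12) := by
    intro c s' hw hp hc hc'
    refine ⟨hw, hcol.painted H hf hv hp hc', fun x hx => ?_, ?_, hp.unvisited_add_le hc hlt hz⟩
    · by_cases hx' : ∃ j < Function.minimalPeriod f v, x = f^[j] v
      · obtain ⟨j, hj, rfl⟩ := hx'
        exact absurd (hz j) hx
      · rwa [hp.2 x fun j hj h => hx' ⟨j, hj, h⟩]
    · have := hp.1 0 hpos
      simp only [Function.iterate_zero, id] at this
      rw [this]
      exact hc 0
  have ha : ∀ j, altColor 3 4 j ≠ 0 := by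
    intro j
    rw [altColor]
    split_ifs <;> norm_num
  have hb : ∀ j, altColor 4 8 j = 4 := by
    intro j
    rw [altColor]
    split_ifs <;> rfl
  have h1 : Reaches W (block [.move 8 4, .const 6 1, .const 9 3, .const 10 4]) s 5 fun s' =>
      s' = (((s.setReg 8 v).setReg 6 1).setReg 9 3).setReg 10 4 := by
    refine (Reaches.of_wp ?_).mono (by decide) fun _ h => h
    simp [wp, h.reg4]
    omega
  refine (h1.seq (T' := 12 * Function.minimalPeriod f v + 15) fun s1 hs1 => ?_).mono (by omega)
    fun _ h => h
  have hw1 : WalkInv n nb op f v s1 := by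
    rw [hs1]
    exact (((h.setReg (by norm_num)).setReg (by norm_num)).setReg (by norm_num)).setReg
      (by norm_num)
  have e1 : s1.mem = s.mem := by rw [hs1]; rfl
  have h2 := walk_reaches (W := W) (a := 3) (K := 4) (T := 1) hw1 hper (by simp [hs1])
    (by simp [hs1, h7]) (by simp [hs1]) (by simp [hs1]) (by simp [hs1]) (by norm_num) (by norm_num)
    (by norm_num) (by rw [e1]; intro j; rw [hz j]; norm_num)
  rw [e1] at h2
  refine (h2.seq (T' := 6 * Function.minimalPeriod f v + 14) fun s2 hs2 => ?_).mono (by omega)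
    fun _ h => h
  obtain ⟨hw2, r7, r8, r9, hp2⟩ := hs2
  refine (Reaches.seq (T := 6 * Function.minimalPeriod f v + 12 + 1) (T' := 1)
    (Reaches.branch (fun hc => ?_) fun hc => ?_)
    fun s h => ⟨1, s, .skip s, le_rfl, h⟩).mono (by omega) fun _ h => h
  -- The parity of the cycle is read off from the color that would come next: it is 1 after an odd
  -- and 3 after an even number of steps.
  · rw [Test.Holds, r9, hw2.reg3, altColor] at hc
    have hodd : Odd (Function.minimalPeriod f v) := by
      rw [← Nat.not_even_iff_odd]
      intro he
      rw [if_pos he] at hc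
      omega
    have h3 : Reaches W (block [.const 6 4, .const 9 4, .const 10 8]) s2 4 fun s' =>
        s' = ((s2.setReg 6 4).setReg 9 4).setReg 10 8 := by
      refine (Reaches.of_wp ?_).mono (by decide) fun _ h => h
      simp [wp]
      omega
    refine (h3.seq (T' := 6 * Function.minimalPeriod f v + 2) fun s3 hs3 => ?_).mono (by omega)
      fun _ h => h
    have hw3 : WalkInv n nb op f v s3 := by
      rw [hs3]
      exact ((hw2.setReg (by norm_num)).setReg (by norm_num)).setReg (by norm_num)
    have e3 : s3.mem = s2.mem := by rw [hs3]; rfl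
    -- The colors 1 and 3 of the first walk lie below the new threshold 4, and `8 - 4 = 4` makes the
    -- alternation constant.
    have h4 := walk_reaches (W := W) (a := 4) (K := 8) (T := 4) hw3 hper (by simp [hs3])
      (by simp [hs3, r7]) (by simp [hs3, r8]) (by simp [hs3]) (by simp [hs3]) (by norm_num)
      (by norm_num) (by norm_num) (by
        intro j
        rw [e3]
        by_cases hx' : ∃ i < Function.minimalPeriod f v, f^[j] v = f^[i] v
        · obtain ⟨i, hi, h⟩ := hx'
          rw [h, hp2.1 i hi, altColor]
          split_ifs <;> norm_num
        · rw [hp2.2 _ fun i hi h => hx' ⟨i, hi, h⟩, hz j]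
          norm_num)
    rw [e3] at h4
    refine (h4.seq (T' := 1) fun s4 hs4 => ⟨1, s4, .skip s4, le_rfl, ?_⟩).mono (by omega)
      fun _ h => h
    obtain ⟨hw4, -, -, -, hp4⟩ := hs4
    exact fin _ s4 hw4 (hp2.trans hp4) (fun j => by rw [hb]; norm_num) (Or.inl ⟨hodd, hb⟩)
  · rw [Test.Holds, r9, hw2.reg3, altColor] at hc
    have heven : Even (Function.minimalPeriod f v) := by
      by_contra he
      rw [if_neg he] at hc
      omega
    exact ⟨1, s2, .skip s2, by omega, fin _ s2 hw2 hp2 ha (Or.inr ⟨heven, rfl⟩)⟩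

theorem color_reaches (hW : 20 * (n + 1) ≤ W) (H : Arcs n nb op) (hf : ArcPerm n nb f) {s : State}
    (h : WalkInv n nb op f 0 (s.setReg 4 0)) (h12 : s.mem 12 = 0) :
    Reaches W color s (60 * (n + 1)) (fun s' =>
      WalkInv n nb op f n s' ∧ Colored n f (s'.mem 12) ∧ ∀ u < n, s'.mem 12 u ≠ 0) := by
  have h' : Reaches W (.const 4 0) s 1 fun s' => s' = s.setReg 4 0 :=
    Reaches.of_wp ⟨by omega, rfl⟩
  refine (h'.seq (T' := 60 * n + 59) fun s1 hs1 => ?_).mono (by omega) fun _ h => h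
  rw [← hs1] at h
  have h12 : s1.mem 12 = 0 := by rw [hs1]; exact h12
  -- Each uncolored vertex carries 12 units for up to two walks of 6 steps per vertex; the 30 units
  -- for each remaining vertex pay for the overhead.
  obtain ⟨k', hk', hr⟩ := Reaches.loop (W := W) (c := .lt 4 0) (p := colorVertex)
    (fun m s' => ∃ v ≤ n, m = 30 * (n - v) + 12 * unvisited n (s'.mem 12) ∧
      WalkInv n nb op f v s' ∧ Colored n f (s'.mem 12) ∧ ∀ u < v, s'.mem 12 u ≠ 0)
    (by
      rintro m s ⟨v, hv, rfl, hs, hcol, hvis⟩ hc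
      simp only [Test.Holds, hs.reg4, hs.reg0] at hc
      have h1 : Reaches W (.load 7 12 4) s 1 (fun s' => s' = s.setReg 7 (s.mem 12 v)) := by
        refine Reaches.of_wp ?_
        simp [wp, hs.reg4]
      have h2 : ∀ s' : State, WalkInv n nb op f v s' →
          Reaches W (block [.add 4 4 3]) s' 2 fun s'' => s'' = s'.setReg 4 (v + 1) := by
        intro s' hs'
        refine Reaches.of_wp ?_
        simp [wp, hs'.reg4, hs'.reg3]
        omega
      have h3 : ∀ s' : State, WalkInv n nb op f v s' →
          WalkInv n nb op f (v + 1) (s'.setReg 4 (v + 1)) := by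
        rintro s' ⟨⟨h0, h1, h2, h3, m0⟩, h4, m1, m2, m11⟩
        exact ⟨⟨by simpa, by simpa, by simpa, by simpa, m0⟩, by simp, m1, m2, m11⟩
      by_cases h0 : s.mem 12 v = 0
      · refine ⟨12 * Function.minimalPeriod f v + 24, (h1.seq
          (T' := 12 * Function.minimalPeriod f v + 23) fun s' hs' => ?_).mono (by omega) fun _ h => h⟩
        have hw : WalkInv n nb op f v s' := hs' ▸ hs.setReg (by norm_num)
        have e : s'.mem = s.mem := by rw [hs']; rfl
        refine (Reaches.seq (T := 12 * Function.minimalPeriod f v + 20 + 1) (T' := 2)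
          (Reaches.branch (fun _ => colorCycle_reaches hW H hf hc hw (by simp [hs'])
            (by rwa [e]) (by rwa [e])) fun hn => absurd ?_ hn) fun s'' hs'' => ?_)
        · rw [Test.Holds, hw.reg3, hs']
          simp [h0]
        · rw [e] at hs''
          obtain ⟨hw', hcol', hmono, hv', hun⟩ := hs''
          refine (h2 s'' hw').mono le_rfl ?_
          rintro _ rfl
          refine ⟨_, ⟨v + 1, hc, rfl, h3 s'' hw', hcol', fun u hu => ?_⟩, ?_⟩
          · obtain hu | rfl : u < v ∨ u = v := by omega
            · exact hmono u (hvis u hu)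
            · exact hv'
          · rw [State.setReg_mem]
            omega
      · refine ⟨20, (h1.seq (T' := 10) fun s' hs' => ?_).mono (by omega) fun _ h => h⟩
        have hw : WalkInv n nb op f v s' := hs' ▸ hs.setReg (by norm_num)
        have e : s'.mem = s.mem := by rw [hs']; rfl
        refine (Reaches.seq (T := 7 + 1) (T' := 2) (Q := fun s'' => s'' = s')
          (Reaches.branch (fun hn => absurd hn ?_) fun _ =>
            ⟨1, s', .skip s', by norm_num, rfl⟩) fun s'' hs'' => ?_)
        · rw [Test.Holds, hw.reg3, hs']
          simpa using h0
        · subst hs''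
          refine (h2 s'' hw).mono le_rfl ?_
          rintro _ rfl
          refine ⟨_, ⟨v + 1, hc, rfl, h3 s'' hw, by rwa [State.setReg_mem, e], fun u hu => ?_⟩, ?_⟩
          · rw [State.setReg_mem, e]
            obtain hu | rfl : u < v ∨ u = v := by omega
            · exact hvis u hu
            · exact h0
          · rw [State.setReg_mem, e]
            omega) _ s1 ⟨0, Nat.zero_le _, rfl, h, fun u _ => by simp [h12], fun u hu => by omega⟩
  have hun : unvisited n (s1.mem 12) ≤ n :=
    (Finset.card_filter_le _ _).trans (Finset.card_range n).le
  refine (hr.seq (T' := 1) fun s hs => ⟨1, s, .skip s, le_rfl, ?_⟩).mono (by omega) fun _ h => h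
  obtain ⟨⟨v, hv, -, hw, hcol, hvis⟩, hc⟩ := hs
  simp only [Test.Holds, hw.reg4, hw.reg0] at hc
  obtain rfl : v = n := by omega
  exact ⟨hw, hcol, hvis⟩

end RAM

/-! ### The 2-matching of a colored permutation -/

section ColoredPerm

variable {V : Type*} {G : SimpleGraph V}

/-- A permutation that moves every vertex along an edge and has no cycles of length 3, together with
a coloring of its cycles: odd cycles have the color 4, and the colors 1 and 3 alternate on even
cycles. -/
structure ColoredPerm (G : SimpleGraph V) (σ : Equiv.Perm V) (col : V → ℕ) : Prop where
  adj : ∀ v, G.Adj v (σ v)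
  no_three : ∀ v, σ (σ (σ v)) ≠ v
  colored : ∀ v, (col v = 1 ∧ col (σ v) = 3) ∨ (col v = 3 ∧ col (σ v) = 1) ∨
    (col v = 4 ∧ col (σ v) = 4 ∧ Odd (Function.minimalPeriod σ v))

open Classical in
/-- The 2-matching of a colored permutation: value 1 on odd cycles, alternatingly 2 and 0 on even
cycles. -/
noncomputable def permMatching (σ : Equiv.Perm V) (col : V → ℕ) (e : G.edgeSet) : ℕ :=
  if ∃ u, col u = 4 ∧ (e : Sym2 V) = s(u, σ u) then 1
  else if ∃ u, col u = 3 ∧ (e : Sym2 V) = s(u, σ u) then 2 else 0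

variable {σ : Equiv.Perm V} {col : V → ℕ}

theorem exists_mk_eq_iff (k : ℕ) (v w : V) :
    (∃ u, col u = k ∧ s(v, w) = s(u, σ u)) ↔ (σ v = w ∧ col v = k) ∨ (σ w = v ∧ col w = k) := by
  constructor
  · rintro ⟨u, hu, he⟩
    rw [Sym2.eq_iff] at he
    rcases he with ⟨rfl, rfl⟩ | ⟨rfl, rfl⟩
    · exact Or.inl ⟨rfl, hu⟩
    · exact Or.inr ⟨rfl, hu⟩
  · rintro (⟨rfl, h⟩ | ⟨rfl, h⟩)
    · exact ⟨v, h, rfl⟩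
    · exact ⟨w, h, Sym2.eq_swap⟩

open Classical in
theorem permMatching_mk {v w : V} (h : s(v, w) ∈ G.edgeSet) :
    permMatching σ col (⟨s(v, w), h⟩ : G.edgeSet) =
      if (σ v = w ∧ col v = 4) ∨ (σ w = v ∧ col w = 4) then 1
      else if (σ v = w ∧ col v = 3) ∨ (σ w = v ∧ col w = 3) then 2 else 0 := by
  simp only [permMatching, exists_mk_eq_iff]

theorem permMatching_le_two (e : G.edgeSet) : permMatching σ col e ≤ 2 := by
  rw [permMatching]
  split_ifs <;> norm_num

theorem suppGraph_permMatching_adj {v w : V} (hvw : (suppGraph (permMatching σ col : G.edgeSet → ℕ)).Adj v w) :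
    (σ v = w ∧ col v ≠ 1) ∨ (σ w = v ∧ col w ≠ 1) := by
  classical
  rw [suppGraph, SimpleGraph.fromEdgeSet_adj] at hvw
  obtain ⟨⟨he, hx⟩, -⟩ := hvw
  rw [permMatching_mk] at hx
  split_ifs at hx with h1 h2
  · rcases h1 with ⟨h1, h2⟩ | ⟨h1, h2⟩
    · exact Or.inl ⟨h1, by omega⟩
    · exact Or.inr ⟨h1, by omega⟩
  · rcases h2 with ⟨h1, h2⟩ | ⟨h1, h2⟩
    · exact Or.inl ⟨h1, by omega⟩
    · exact Or.inr ⟨h1, by omega⟩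
  · exact absurd rfl hx

theorem exists_walk_iterate (hadj : ∀ v, G.Adj v (σ v)) (k : ℕ) (v w : V)
    (hk : σ^[k] v = w) : ∃ p : G.Walk v w, p.length = k ∧
      p.support = (List.range (k + 1)).map (fun i => σ^[i] v) ∧
      p.edges = (List.range k).map (fun i => s(σ^[i] v, σ^[i + 1] v)) := by
  induction k generalizing v with
  | zero =>
    obtain rfl : v = w := hk
    exact ⟨.nil, rfl, rfl, rfl⟩
  | succ k ih =>
    obtain ⟨p, h1, h2, h3⟩ := ih (σ v) hk
    refine ⟨.cons (hadj v) p, by simp [h1], ?_, ?_⟩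
    · rw [SimpleGraph.Walk.support_cons, h2, List.range_succ_eq_map (n := k + 1), List.map_cons,
        List.map_map]
      rfl
    · rw [SimpleGraph.Walk.edges_cons, h3, List.range_succ_eq_map (n := k), List.map_cons,
        List.map_map]
      rfl

namespace ColoredPerm

theorem ne (h : ColoredPerm G σ col) (v : V) : σ v ≠ v := (h.adj v).ne'

/-- An odd period that divides 2 is 1, and edges are not loops. Hence the two cycle edges at a
vertex of an odd cycle are distinct. -/
theorem ne_of_odd (h : ColoredPerm G σ col) {v : V} (hv : col v = 4) : σ (σ v) ≠ v := by
  intro h2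
  have hodd : Odd (Function.minimalPeriod σ v) := by
    rcases h.colored v with h | h | h
    · omega
    · omega
    · exact h.2.2
  have hdvd : Function.minimalPeriod σ v ∣ 2 :=
    Function.IsPeriodicPt.minimalPeriod_dvd (show σ^[2] v = v from h2)
  rcases (Nat.dvd_prime Nat.prime_two).1 hdvd with h1 | h1
  · exact h.ne v (Function.minimalPeriod_eq_one_iff_isFixedPt.1 h1)
  · rw [h1] at hodd
    exact absurd hodd (by decide)

/-- At color 1 the only contribution is 2 from the predecessor's edge, at color 3 it is 2 from the
edge to the successor, and at color 4 two distinct edges contribute 1 each. -/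
theorem incidentSum_eq (h : ColoredPerm G σ col) [Fintype V] (v : V) :
    incidentSum (permMatching σ col : G.edgeSet → ℕ) v = 2 := by
  classical
  obtain ⟨u, hu⟩ := σ.surjective v
  have hv := h.colored v
  have hcu := h.colored u
  rw [hu] at hcu
  have adj1 : s(v, σ v) ∈ G.edgeSet := h.adj v
  have adj2 : s(v, u) ∈ G.edgeSet := by
    have := (h.adj u).symm
    rwa [hu] at this
  let e₁ : G.edgeSet := ⟨s(v, σ v), adj1⟩
  let e₂ : G.edgeSet := ⟨s(v, u), adj2⟩
  have other : ∀ e : G.edgeSet, v ∈ (e : Sym2 V) → ∃ w, ∃ hw : s(v, w) ∈ G.edgeSet,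
      e = ⟨s(v, w), hw⟩ := by
    rintro ⟨e, he⟩ hve
    obtain ⟨w, rfl⟩ := Sym2.mem_iff_exists.1 hve
    exact ⟨w, he, rfl⟩
  have hinj : ∀ w, σ w = v → w = u := fun w hw => σ.injective (hw.trans hu.symm)
  rw [incidentSum]
  rcases hv with ⟨hv, hv'⟩ | ⟨hv, hv'⟩ | ⟨hv, hv', hodd⟩
  · rw [Finset.sum_eq_single e₂]
    · simp only [e₂, permMatching_mk, Sym2.mem_iff, true_or, if_true, hu, true_and, hv]
      have h1 : col u = 3 := by omega
      simp [h1]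
    · intro e _ hne
      split_ifs with hve
      · obtain ⟨w, hw, rfl⟩ := other e hve
        rw [permMatching_mk]
        have hwu : σ w ≠ v := fun hw' => hne (by simp only [e₂, hinj w hw'])
        simp [hv, hwu]
      · rfl
    · simp
  · rw [Finset.sum_eq_single e₁]
    · simp only [e₁, permMatching_mk, Sym2.mem_iff, true_or, if_true, hv, true_and]
      simp [hv']
    · intro e _ hne
      split_ifs with hve
      · obtain ⟨w, hw, rfl⟩ := other e hve
        rw [permMatching_mk]
        have hwv : σ v ≠ w := fun hw' => hne (by simp only [e₁, hw'])
        have hw4 : ∀ k, k = 3 ∨ k = 4 → ¬ (σ w = v ∧ col w = k) := by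
          rintro k hk ⟨hw', hk'⟩
          rw [hinj w hw'] at hk'
          omega
        simp [hwv, hw4]
      · rfl
    · simp
  · have hcu4 : col u = 4 := by omega
    have hne : e₁ ≠ e₂ := by
      intro he
      have : s(v, σ v) = s(v, u) := congrArg Subtype.val he
      rw [Sym2.congr_right] at this
      exact h.ne_of_odd hv (by rw [this, hu])
    rw [Finset.sum_eq_add e₁ e₂ hne]
    · simp only [e₁, e₂, permMatching_mk, Sym2.mem_iff, true_or, if_true, hv, hu, hcu4, true_and,
        or_true]
    · rintro e - ⟨hne1, hne2⟩
      split_ifs with hve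
      · obtain ⟨w, hw, rfl⟩ := other e hve
        rw [permMatching_mk]
        have hwv : σ v ≠ w := fun hw' => hne1 (by simp only [e₁, hw'])
        have hwu : σ w ≠ v := fun hw' => hne2 (by simp only [e₂, hinj w hw'])
        simp [hwv, hwu]
      · rfl
    · simp
    · simp

theorem isTwoMatching (h : ColoredPerm G σ col) [Fintype V] : IsTwoMatching (permMatching σ col : G.edgeSet → ℕ) :=
  ⟨permMatching_le_two, fun v => (h.incidentSum_eq v).le⟩

/-- Double counting: each edge has two ends, and the sum at each node is 2. -/
theorem isPerfect (h : ColoredPerm G σ col) [Fintype V] : IsPerfect (permMatching σ col : G.edgeSet → ℕ) := by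
  classical
  have h1 : ∑ v : V, incidentSum (permMatching σ col : G.edgeSet → ℕ) v = 2 * Fintype.card V := by
    rw [Finset.sum_congr rfl fun v _ => h.incidentSum_eq v, Finset.sum_const, Finset.card_univ,
      smul_eq_mul, mul_comm]
  have h2 : ∑ v : V, incidentSum (permMatching σ col : G.edgeSet → ℕ) v =
      2 * edgeSize (permMatching σ col : G.edgeSet → ℕ) := by
    simp only [incidentSum, edgeSize]
    rw [Finset.sum_comm, Finset.mul_sum]
    refine Finset.sum_congr (by congr!) fun e _ => ?_
    obtain ⟨e, he⟩ := e
    induction e using Sym2.ind with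
    | _ a b =>
      have hab : a ≠ b := G.ne_of_adj he
      rw [← Finset.sum_filter, Finset.sum_const, smul_eq_mul]
      congr 1
      rw [← Finset.card_pair hab]
      congr 1
      ext v
      simp
  rw [IsPerfect]
  omega

/-- Each edge of the support joins a vertex to its image. In a triangle of such edges every vertex
has at most one outgoing and one incoming edge, so the triangle is a 3-cycle of `σ`. -/
theorem isTriangleFree (h : ColoredPerm G σ col) : IsTriangleFree (permMatching σ col : G.edgeSet → ℕ) := by
  classical
  intro s hs
  obtain ⟨a, b, c, hab, hac, hbc, -⟩ := SimpleGraph.is3Clique_iff.1 hs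
  have nab := hab.ne
  have nac := hac.ne
  have nbc := hbc.ne
  have e1 := suppGraph_permMatching_adj hab
  have e2 := suppGraph_permMatching_adj hac
  have e3 := suppGraph_permMatching_adj hbc
  have i1 := σ.injective (a₁ := a) (a₂ := b)
  have i2 := σ.injective (a₁ := a) (a₂ := c)
  have i3 := σ.injective (a₁ := b) (a₂ := c)
  have t1 := h.no_three a
  have t2 := h.no_three b
  have t3 := h.no_three c
  grind

theorem color_eq_of_sameCycle (h : ColoredPerm G σ col) [Finite V] {v w : V} (hv : col v = 4) (hvw : σ.SameCycle v w) :
    col w = 4 := by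
  obtain ⟨i, rfl⟩ := hvw.exists_nat_pow_eq
  rw [← Equiv.Perm.iterate_eq_pow]
  induction i with
  | zero => exact hv
  | succ i ih =>
    rw [Function.iterate_succ_apply']
    have := h.colored (σ^[i] v)
    have := ih (Equiv.Perm.sameCycle_pow_right.2 (Equiv.Perm.SameCycle.refl σ v))
    omega

theorem exists_cycle (h : ColoredPerm G σ col) [Finite V] {v : V} (hv : col v = 4) : ∃ c : G.Walk v v,
    c.IsCycle ∧ Odd c.length ∧ (∀ w, w ∈ c.support → σ.SameCycle v w) ∧
    ∀ e, e ∈ c.edges ↔ ∃ u, σ.SameCycle v u ∧ e = s(u, σ u) := by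
  have hodd : Odd (Function.minimalPeriod σ v) := by
    rcases h.colored v with h | h | h
    · omega
    · omega
    · exact h.2.2
  obtain ⟨m, hm⟩ : ∃ m, Function.minimalPeriod σ v = m + 1 :=
    ⟨_, (Nat.sub_add_cancel hodd.pos).symm⟩
  have hend : σ^[m + 1] v = v := by rw [← hm]; exact Function.iterate_minimalPeriod
  have hinj : ∀ i j, i < m + 1 → j < m + 1 → σ^[i] v = σ^[j] v → i = j := by
    intro i j hi hj
    rw [← hm] at hi hj
    exact fun h => Function.iterate_injOn_Iio_minimalPeriod hi hj h
  have same : ∀ i, σ.SameCycle v (σ^[i] v) := fun i => by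
    rw [Equiv.Perm.iterate_eq_pow]
    exact Equiv.Perm.sameCycle_pow_right.2 (Equiv.Perm.SameCycle.refl σ v)
  -- The circuit is the edge from `v` to `σ v` followed by the path of iterates from `σ v` back to
  -- `v`. That path could contain the first edge only if `σ (σ v) = v`.
  obtain ⟨p, h1, h2, h3⟩ := exists_walk_iterate h.adj m (σ v) v hend
  have e3 : p.edges = (List.range m).map (fun i => s(σ^[i + 1] v, σ^[i + 1 + 1] v)) := h3
  have e2 : p.support = (List.range (m + 1)).map (fun i => σ^[i + 1] v) := h2
  refine ⟨.cons (h.adj v) p, ?_, ?_, ?_, ?_⟩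
  · rw [SimpleGraph.Walk.cons_isCycle_iff, SimpleGraph.Walk.isPath_def, e2, e3]
    constructor
    · refine List.Nodup.map_on ?_ List.nodup_range
      intro i hi j hj hij
      rw [List.mem_range] at hi hj
      rw [Function.iterate_succ_apply', Function.iterate_succ_apply'] at hij
      exact hinj i j hi hj (σ.injective hij)
    · intro hmem
      obtain ⟨i, hi, he⟩ := List.mem_map.1 hmem
      rw [List.mem_range] at hi
      rw [Sym2.eq_iff] at he
      rcases he with ⟨he, -⟩ | ⟨he, he'⟩
      · have := hinj (i + 1) 0 (by omega) (by omega) he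
        omega
      · rw [Function.iterate_succ_apply', he] at he'
        exact h.ne_of_odd hv he'
  · rw [SimpleGraph.Walk.length_cons, h1, ← hm]
    exact hodd
  · intro w hw
    rw [SimpleGraph.Walk.support_cons, e2, List.mem_cons, List.mem_map] at hw
    rcases hw with rfl | ⟨i, -, rfl⟩
    · exact same 0
    · exact same (i + 1)
  · intro e
    rw [SimpleGraph.Walk.edges_cons, e3, List.mem_cons, List.mem_map]
    constructor
    · rintro (rfl | ⟨i, -, rfl⟩)
      · exact ⟨v, same 0, rfl⟩
      · exact ⟨σ^[i + 1] v, same (i + 1), by rw [← Function.iterate_succ_apply' σ]⟩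
    · rintro ⟨u, hu, rfl⟩
      obtain ⟨i, rfl⟩ := hu.exists_nat_pow_eq
      rw [← Equiv.Perm.iterate_eq_pow, ← Function.iterate_mod_minimalPeriod_eq, hm]
      have hlt := Nat.mod_lt i (Nat.succ_pos m)
      rcases hi : i % (m + 1) with _ | j
      · exact Or.inl rfl
      · rw [Nat.succ_eq_add_one, hi] at hlt
        exact Or.inr ⟨j, List.mem_range.2 (by omega), by rw [← Function.iterate_succ_apply' σ]⟩

theorem isBasic (h : ColoredPerm G σ col) [Finite V] : IsBasic (permMatching σ col : G.edgeSet → ℕ) := by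
  classical
  choose c hc using fun v (hv : col v = 4) => h.exists_cycle hv
  -- One representative per cycle of `σ`: circuits based at different vertices of the same cycle
  -- would be different walks with the same support, contradicting disjointness.
  let rep : V → V := fun v => (Quotient.mk (Equiv.Perm.SameCycle.setoid σ) v).out
  have rep_same : ∀ v, σ.SameCycle (rep v) v := fun v =>
    Quotient.exact (s := Equiv.Perm.SameCycle.setoid σ) (Quotient.out_eq _)
  have rep_eq : ∀ v w, σ.SameCycle v w → rep v = rep w := fun v w hvw =>
    congrArg Quotient.out (Quotient.sound (s := Equiv.Perm.SameCycle.setoid σ) hvw)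
  refine ⟨{d | ∃ v, ∃ hv : col v = 4, rep v = v ∧ d = ⟨v, c v hv⟩}, ?_, ?_, ?_⟩
  · rintro d ⟨v, hv, -, rfl⟩
    exact ⟨(hc v hv).1, (hc v hv).2.1⟩
  · rintro d ⟨v, hv, hr, rfl⟩ d' ⟨v', hv', hr', rfl⟩ hne
    refine Set.disjoint_left.2 fun w hw hw' => hne ?_
    have h1 := rep_eq _ _ ((hc v hv).2.2.1 w hw)
    have h2 := rep_eq _ _ ((hc v' hv').2.2.1 w hw')
    obtain rfl : v = v' := by rw [← hr, ← hr', h1, h2]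
    rfl
  · intro e
    have h1 : permMatching σ col e = 1 ↔ ∃ u, col u = 4 ∧ (e : Sym2 V) = s(u, σ u) := by
      rw [permMatching]
      split_ifs with h1 h2
      · simp [h1]
      · simp [h1]
      · simp [h1]
    rw [h1]
    constructor
    · rintro ⟨u, hu, he⟩
      have hs := rep_same u
      have hr := h.color_eq_of_sameCycle hu hs.symm
      exact ⟨_, ⟨rep u, hr, rep_eq _ _ hs, rfl⟩, ((hc _ hr).2.2.2 _).2 ⟨u, hs, he⟩⟩
    · rintro ⟨d, ⟨v, hv, -, rfl⟩, he⟩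
      obtain ⟨u, hu, he'⟩ := ((hc v hv).2.2.2 _).1 he
      exact ⟨u, h.color_eq_of_sameCycle hv hu, he'⟩

end ColoredPerm

end ColoredPerm

/-! ### Writing the output -/

/-- The value of the slot `s` that is determined by the permutation `f` and the colors `vis`. -/
def slotValue (nb f vis : ℕ → ℕ) (s : ℕ) : ℕ :=
  if (f (s / 3) = nb s ∧ vis (s / 3) = 4) ∨ (f (nb s) = s / 3 ∧ vis (nb s) = 4) then 1
  else if (f (s / 3) = nb s ∧ vis (s / 3) = 3) ∨ (f (nb s) = s / 3 ∧ vis (nb s) = 3) then 2 else 0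

namespace RAM

variable {n W : ℕ} {nb op f vis : ℕ → ℕ}

/-- Puts the value 1 or 2 into register 13 if register `c` has the contents 4 or 3. -/
def colorValue (c : ℕ) : Prog :=
  .branch (.eq c 14) (.const 13 1) (.branch (.eq c 15) (.const 13 2) .skip)

/-- Writes the value of the slot in register 4. -/
def writeSlot : Prog :=
  block [.load 5 2 4, .load 6 0 5, .load 7 0 4, .load 8 11 6, .load 9 11 7, .load 10 12 6,
    .load 11 12 7, .const 13 0, .branch (.eq 8 7) (colorValue 10) .skip,
    .branch (.eq 9 6) (colorValue 11) .skip, .store 1 4 13, .add 4 4 3]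

/-- Writes the 2-matching. -/
def write : Prog :=
  block [block [.const 4 0, .const 14 4, .const 15 3], .loop (.lt 4 1) writeSlot]

structure WriteInv (n : ℕ) (nb op f vis : ℕ → ℕ) (i : ℕ) (s : State) : Prop
    extends Frame n nb s where
  reg4 : s.reg 4 = i
  reg14 : s.reg 14 = 4
  reg15 : s.reg 15 = 3
  mem2 : s.mem 2 = op
  mem11 : s.mem 11 = f
  mem12 : s.mem 12 = vis
  mem1 : ∀ j < i, s.mem 1 j = slotValue nb f vis j

/-- Both tests succeed only if `f` swaps the two ends. By the coloring, color 4 at one end then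
forces color 4 at the other, so the second test never replaces a value 1 by 2. -/
theorem writeSlot_reaches (hW : 20 * (n + 1) ≤ W) (H : Arcs n nb op)
    (hcol : Colored n f vis) {i : ℕ} {s : State} (hi : i < 3 * n)
    (h : WriteInv n nb op f vis i s) :
    Reaches W writeSlot s 30 (WriteInv n nb op f vis (i + 1)) := by
  obtain ⟨⟨h0, h1, h2, h3, m0⟩, h4, h14, h15, m2, m11, m12, m1⟩ := h
  refine (Reaches.of_wp (Q := WriteInv n nb op f vis (i + 1)) ?_).mono (by decide) fun _ h => h
  have hu := H.nb_op i hi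
  obtain ⟨u, hu'⟩ : ∃ u, u = i / 3 := ⟨_, rfl⟩
  obtain ⟨w, hw⟩ : ∃ w, w = nb i := ⟨_, rfl⟩
  have hcu := hcol u (by omega)
  have hcw := hcol w (by rw [hw]; exact H.nb_lt i hi)
  rw [← hu'] at hu
  have hi' : i + 1 ≤ W := by omega
  have hW1 : 1 ≤ W := by omega
  have hW2 : 2 ≤ W := by omega
  have key : ∀ (s' : State) (x : ℕ), s'.mem = s.mem → (∀ r, r < 4 ∨ 13 < r → s'.reg r = s.reg r) →
      x = slotValue nb f vis i →
      WriteInv n nb op f vis (i + 1) ((s'.setMem 1 i x).setReg 4 (i + 1)) := by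
    intro s' x hm hr hx
    refine ⟨⟨?_, ?_, ?_, ?_, ?_⟩, ?_, ?_, ?_, ?_, ?_, ?_, ?_⟩
    any_goals simp [hr, hm, h0, h1, h2, h3, h14, h15, m0, m2, m11, m12]
    rw [hx]
    exact fun j hj => update_eq_of_lt_succ m1 rfl j (by omega)
  have hval : slotValue nb f vis i = if (f u = w ∧ vis u = 4) ∨ (f w = u ∧ vis w = 4) then 1
      else if (f u = w ∧ vis u = 3) ∨ (f w = u ∧ vis w = 3) then 2 else 0 := by
    rw [slotValue, ← hu', ← hw]
  rw [hval] at key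
  simp only [writeSlot, colorValue, wp_block_cons, wp_block_nil, wp, Test.Holds, State.setReg_reg,
    State.setReg_mem, State.setMem_reg, h3, h4, h14, h15, m0, m2, m11, m12, ← hw, hu,
    Nat.reduceEqDiff, if_true, if_false]
  have frame : ∀ r, r < 4 ∨ 13 < r → r ≠ 5 ∧ r ≠ 6 ∧ r ≠ 7 ∧ r ≠ 8 ∧ r ≠ 9 ∧ r ≠ 10 ∧ r ≠ 11 ∧
      r ≠ 13 := by
    omega
  refine ⟨Nat.zero_le _, ?_⟩
  repeat' first
    | with_reducible assumption
    | refine key _ _ rfl (fun r hr => by simp [frame r hr]) ?_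
    | with_reducible refine And.intro ?_ ?_
    | intro _
  all_goals
    clear key frame hval
    grind

theorem write_reaches (hW : 20 * (n + 1) ≤ W) (H : Arcs n nb op)
    {s : State} (h : WalkInv n nb op f n s) (hcol : Colored n f (s.mem 12)) :
    Reaches W write s (100 * (n + 1)) (fun s' =>
      ∀ j < 3 * n, s'.mem 1 j = slotValue nb f (s.mem 12) j) := by
  have h1 : Reaches W (block [.const 4 0, .const 14 4, .const 15 3]) s 4
      (WriteInv n nb op f (s.mem 12) 0) := by
    refine (Reaches.of_wp (Q := WriteInv n nb op f (s.mem 12) 0) ?_).mono (by decide) fun _ h => h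
    obtain ⟨⟨h0, h1, h2, h3, m0⟩, h4, m1, m2, m11⟩ := h
    simp only [wp_block_cons, wp_block_nil, wp]
    refine ⟨by omega, by omega, by omega, ⟨?_, ?_, ?_, ?_, ?_⟩, ?_, ?_, ?_, ?_, ?_, ?_, ?_⟩
    any_goals simp [h0, h1, h2, h3, m0, m2, m11]
  refine (h1.seq (T' := 93 * n + 2) fun s1 h => ?_).mono (by omega) fun _ h => h
  refine ((Reaches.loop_lt (T := 30) (N := 3 * n) (fun i => WriteInv n nb op f (s.mem 12) i)
    (fun m s hs => ⟨hs.reg4, hs.reg1⟩)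
    (fun m s hm hs => writeSlot_reaches hW H hcol hm hs) h).seq
    (T' := 1) fun s h => ⟨1, s, .skip s, le_rfl, ?_⟩).mono (by omega) fun _ h => h
  exact h.mem1

/-- The program of the theorem. -/
def findMatching : Prog :=
  block [findPermutation, color, write]

theorem findMatching_reaches (hW : 20 * (n + 1) ≤ W) (H : Arcs n nb op) {s : State}
    (hn : ∀ i, s.reg i = if i = 0 then n else 0) (m0 : s.mem 0 = nb)
    (mz : ∀ b, b ≠ 0 → s.mem b = 0) :
    Reaches W findMatching s (2000 * (n + 1)) (fun s' => ∃ f vis, ArcPerm n nb f ∧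
      Colored n f vis ∧ (∀ u < n, vis u ≠ 0) ∧
      ∀ j < 3 * n, s'.mem 1 j = slotValue nb f vis j) := by
  refine ((findPermutation_reaches hW H hn m0 mz).seq (T' := 500 * n + 500) fun s1 h => ?_).mono
    (by omega) fun _ h => h
  obtain ⟨op, h⟩ := h
  have hw : WalkInv n nb op (s1.mem 11) 0 (s1.setReg 4 0) := by
    obtain ⟨⟨h0, h1, h2, h3, m0⟩, H, m2, hf, mz⟩ := h
    refine ⟨⟨?_, ?_, ?_, ?_, ?_⟩, ?_, ?_, ?_, ?_⟩
    any_goals simp [h0, h1, h2, h3, m0, m2]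
    exact mz 1 (by norm_num)
  refine ((color_reaches hW h.arcs h.perm hw (h.mem_zero 12 (by norm_num))).seq
    (T' := 400 * n + 400) fun s2 h2 => ?_).mono (by omega) fun _ h => h
  obtain ⟨hw, hcol, hvis⟩ := h2
  refine ((write_reaches hW h.arcs hw hcol).seq (T' := 1)
    fun s h' => ⟨1, s, .skip s, le_rfl, ?_⟩).mono (by omega) fun _ h => h
  exact ⟨_, _, h.perm, hcol, hvis, h'⟩

end RAM

/-! ### Transfer to the given graph and conclusion -/

section

variable {n : ℕ} {G : SimpleGraph (Fin n)} (A : CubicAdjList G) {f vis : ℕ → ℕ}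

theorem CubicAdjList.adj_of_hasArc {v w : Fin n} (h : HasArc n (A.input.mem 0) v w) : G.Adj v w := by
  obtain ⟨c, hc, h1, h2⟩ := h
  obtain ⟨u, j, rfl⟩ := exists_slot hc
  rw [A.input_slot] at h2
  obtain rfl : u = v := by ext; omega
  exact (A.adj_iff _ _).2 ⟨j, Fin.ext h2⟩

theorem ArcPerm.exists_coloredPerm (hf : ArcPerm n (A.input.mem 0) f) (hcol : Colored n f vis)
    (hvis : ∀ u < n, vis u ≠ 0) : ∃ σ : Equiv.Perm (Fin n),
      (∀ v, (σ v : ℕ) = f v) ∧ ColoredPerm G σ (fun v => vis v) := by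
  have hlt : ∀ v < n, f v < n := fun v hv => hf.mapsTo A.arcs hv
  let g : Fin n → Fin n := fun v => ⟨f v, hlt v v.2⟩
  have hg : Function.Injective g := fun a b hab =>
    Fin.ext (hf.inj a a.2 b b.2 (congrArg Fin.val hab))
  let σ : Equiv.Perm (Fin n) := Equiv.ofBijective g (Finite.injective_iff_bijective.1 hg)
  have hσ : ∀ v, (σ v : ℕ) = f v := fun v => rfl
  have hiter : ∀ (k : ℕ) (v : Fin n), ((σ^[k] v : Fin n) : ℕ) = f^[k] v := by
    intro k v
    induction k with
    | zero => rfl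
    | succ k ih => rw [Function.iterate_succ_apply', Function.iterate_succ_apply', hσ, ih]
  refine ⟨σ, hσ, fun v => A.adj_of_hasArc (by rw [hσ]; exact hf.arc v v.2), fun v h => ?_,
    fun v => ?_⟩
  · apply hf.no_three v v.2
    rw [← hσ, ← hσ, ← hσ, h]
  · have hp : Function.minimalPeriod σ v = Function.minimalPeriod f v := by
      rw [Function.minimalPeriod_eq_minimalPeriod_iff]
      intro k
      rw [Function.IsPeriodicPt, Function.IsFixedPt, Function.IsPeriodicPt, Function.IsFixedPt,
        ← hiter, Fin.val_inj]
    rw [hp, hσ]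
    exact (hcol v v.2).resolve_left fun h => hvis v v.2 h.1

theorem CubicAdjList.outputs {σ : Equiv.Perm (Fin n)} (hσ : ∀ v, (σ v : ℕ) = f v) {s : RAM.State}
    (h : ∀ j < 3 * n, s.mem 1 j = slotValue (A.input.mem 0) f vis j) :
    A.Outputs s (permMatching σ (fun v => vis v)) := by
  intro v j
  have h1 : (3 * (v : ℕ) + j) / 3 = v := by omega
  refine Eq.trans ?_ (permMatching_mk (v := v) (w := A.nbr v j) (A.edge v j).2).symm
  rw [h _ (by omega), slotValue, h1, A.input_slot]
  simp only [← hσ, Fin.val_inj]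
  congr

end

theorem mainTheorem5 :
    ∃ (P : RAM.Prog) (C : ℕ), ∀ (n : ℕ) (G : SimpleGraph (Fin n)) [DecidableRel G.Adj],
      G.IsRegularOfDegree 3 → ∀ A : CubicAdjList G,
        ∃ (t : ℕ) (s : RAM.State) (x : G.edgeSet → ℕ),
          RAM.Runs (C * (n + 1)) P A.input t s ∧ t ≤ C * (n + 1) ∧ A.Outputs s x ∧
          IsTwoMatching x ∧ IsBasic x ∧ IsPerfect x ∧ IsTriangleFree x := by
  refine ⟨RAM.findMatching, 2000, fun n G _ _ A => ?_⟩
  obtain ⟨t, s, hr, ht, f, vis, hf, hcol, hvis, hout⟩ :=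
    RAM.findMatching_reaches (W := 2000 * (n + 1)) (by omega) A.arcs (s := A.input)
      (fun i => rfl) rfl (fun b hb => by
        ext a
        simp [CubicAdjList.input, hb])
  obtain ⟨σ, hσ, hc⟩ := hf.exists_coloredPerm A hcol hvis
  exact ⟨t, s, _, hr, ht, A.outputs hσ hout, hc.isTwoMatching, hc.isBasic, hc.isPerfect,
    hc.isTriangleFree⟩
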